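/- **Theorem 2.** *Model.* Power beacons form a homogeneous Poisson point process $\Phi=\{x_k\}_{k\ge1}$ of density $\lambda>0$ in $\mathbb R^2$; the gains $H_k\sim\exp(1)$ are i.i.d. and independent of $\Phi$. Let $\eta>2$, $\ell(r,\eta)=\max(1,r^\eta)$, $P_{\rm PB}>0$, $\mu\in(0,1]$. In each of $m\ge 1$ harvesting slots of a frame, an energy-harvesting node at the origin harvests the same random energy $$Z=P_{\rm PB}\,\mu\sum_k \frac{H_k}{\ell(\|x_k\|,\eta)} .$$ Then, in $n$ transmission slots, it sends one of $M$ equiprobable messages $W$ over a real Gaussian channel with noise variance $\sigma^2>0$ (noise i.i.d. and independent of everything else). A codebook consists of intended sequences $X^n(w)=(X_1(w),\dots,X_n(w))$, $1\le w\le M$; to send $w$, the node transmits $X_\ell(w)$ in slot $\ell$ if $\sum_{j\le \ell}X_j(w)^2\le mZ$, and $0$ otherwise, so that it never spends more energy than it harvested. The decoder, which may depend on the codebook, maps the $n$ received symbols to an estimate $\hat W$. In the random Gaussian code with power $P_{\rm t}>0$ all $X_\ell(w)$ are i.i.d. $\mathcal N(0,P_{\rm t})$. A rate $R$ is called $\epsilon$-achievable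 at blocklengths $(m,n)$ if there are an integer $M\ge1$ with $\frac{\log M}{n+m}\ge R$ and a decoding rule for which the random Gaussian code has average error probability $\Pr[\hat W\ne W]\le\epsilon$, and for which some fixed codebook also has average error probability at most $\epsilon$. Logarithms are natural. *Statement.* Let $\epsilon\in(0,1)$, $a=\frac{P_{\rm t}}{\mu P_{\rm PB}}$, $\gamma=\frac{P_{\rm t}}{\sigma^2}$, and let $\mathcal L(s)=\mathbb E\big[e^{-sZ/(\mu P_{\rm PB})}\big]$ be the Laplace transform of the harvested energy in units of $\mu P_{\rm PB}$. For $s\ge0$, $$\mathcal L(s)=\exp\Big(-\pi\lambda\frac{s}{1+s}\Big)\exp\big(-\pi\lambda\,\mathcal F(s,\eta)\big),\qquad \mathcal F(s,\eta)=\frac{2s}{\eta-2}\;{}_2F_1\Big(1,1-\tfrac2\eta;2-\tfrac2\eta;-s\Big)$$ (equivalently, $\mathbb E[e^{-sZ}]=\mathcal L(P_{\rm PB}\,\mu s)$). For all $m\ge 1$ and all even $n$ satisfying $$\sum_{i=0}^{\frac n2-1}(-1)^i\frac{m^i}{(2a)^i\,i!}\,\frac{{\rm d}^i}{{\rm d}s^i}\mathcal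 L(s)\Big|_{s=\frac m{2a}}\le\frac{\epsilon}{2+\epsilon} \qquad\text{and}\qquad n\ge\Big[\log\frac{2+\epsilon}{\epsilon^2}\Big]^4,$$ the rate $$R^{\rm MP}_{\rm EH}(\epsilon,a,\gamma,m,n,\lambda)=\frac{\frac{n\log(1+\gamma)}2-\sqrt{\frac{2+\epsilon}{\epsilon}\,\frac{\gamma}{\gamma+1}\,n}-n^{1/4}-1}{n+m}$$ is $\epsilon$-achievable at blocklengths $(m,n)$. -/

import Mathlib

open MeasureTheory ProbabilityTheory
open scoped ENNReal

noncomputable section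

namespace WirelessPowered

/-! ### The network of power beacons -/

/-- The Euclidean plane, with its Lebesgue measure as `volume`. -/
abbrev Plane : Type := EuclideanSpace ℝ (Fin 2)

/-- Number of points of the random configuration `(x k)` (with multiplicity) that lie in `A`. -/
def pointCount {Ω : Type*} (x : ℕ → Ω → Plane) (A : Set Plane) (ω : Ω) : ℝ≥0∞ :=
  ∑' k, A.indicator (fun _ => (1 : ℝ≥0∞)) (x k ω)

/-- `x` enumerates a homogeneous Poisson point process of intensity `lam` on the plane: the number
of points in a bounded Borel set `A` is Poisson with mean `lam * volume A`, and the numbers of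
points in pairwise disjoint bounded Borel sets are independent. -/
structure IsHomogeneousPPP {Ω : Type*} [MeasurableSpace Ω] (P : Measure Ω) (lam : ℝ)
    (x : ℕ → Ω → Plane) : Prop where
  measurable : ∀ k, Measurable (x k)
  count_law : ∀ A : Set Plane, MeasurableSet A → Bornology.IsBounded A →
    P.map (pointCount x A) =
      (poissonMeasure (lam * (volume A).toReal).toNNReal).map (fun j : ℕ => (j : ℝ≥0∞))
  count_indep : ∀ (j : ℕ) (A : Fin j → Set Plane), (∀ i, MeasurableSet (A i)) →
    (∀ i, Bornology.IsBounded (A i)) → Pairwise (fun i i' => Disjoint (A i) (A i')) →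
    iIndepFun (fun i => pointCount x (A i)) P

/-- `H` is a sequence of i.i.d. Rayleigh-fading power gains (exponential with mean one) that is
independent of the locations `x`. -/
structure IsRayleighFading {Ω : Type*} [MeasurableSpace Ω] (P : Measure Ω)
    (x : ℕ → Ω → Plane) (H : ℕ → Ω → ℝ) : Prop where
  measurable : ∀ k, Measurable (H k)
  law : ∀ k, P.map (H k) = expMeasure 1
  indep : iIndepFun H P
  indep_locations : IndepFun (fun ω k => x k ω) (fun ω k => H k ω) P

/-- Bounded path loss `max (1, r ^ η)`. -/
def pathLoss (r η : ℝ) : ℝ := max 1 (r ^ η)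

/-- Energy harvested per slot by the typical node, located at the origin:
`P_PB * μ * ∑ₖ H k / ℓ(‖x k‖, η)`. -/
def harvestedEnergy {Ω : Type*} (PPB mu η : ℝ) (x : ℕ → Ω → Plane) (H : ℕ → Ω → ℝ) (ω : Ω) : ℝ :=
  PPB * mu * ∑' k, H k ω / pathLoss ‖x k ω‖ η

/-! ### Laplace transforms -/

/-- The Laplace transform `s ↦ 𝔼[exp (-s Z)]` of a random variable. -/
def laplace {Ω : Type*} [MeasurableSpace Ω] (P : Measure Ω) (Z : Ω → ℝ) (s : ℝ) : ℝ :=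
  ∫ ω, Real.exp (-(s * Z ω)) ∂P

/-- Gauss's hypergeometric function `₂F₁(a, b; c; z)` for real parameters `0 < b < c` and `z < 1`,
through Euler's integral. (The power series represents it only for `|z| < 1`, whereas negative
arguments of every size are needed.) -/
def hyp2F1 (a b c z : ℝ) : ℝ :=
  Real.Gamma c / (Real.Gamma b * Real.Gamma (c - b)) *
    ∫ t in (0 : ℝ)..1, t ^ (b - 1) * (1 - t) ^ (c - b - 1) * (1 - z * t) ^ (-a)

/-- `𝓕(u, η) = 2u / (η - 2) * ₂F₁(1, 1 - 2/η; 2 - 2/η; -u)`. -/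
def calF (u η : ℝ) : ℝ :=
  2 * u / (η - 2) * hyp2F1 1 (1 - 2 / η) (2 - 2 / η) (-u)

/-- `exp (-π λ u / (1 + u)) * exp (-π λ 𝓕(u, η))`. -/
def laplaceClosedForm (lam η u : ℝ) : ℝ :=
  Real.exp (-(Real.pi * lam * (u / (1 + u)))) * Real.exp (-(Real.pi * lam * calF u η))

/-- `∑_{i=0}^{n/2-1} (-1)^i m^i / ((2a)^i i!) L^{(i)}(s)` at `s = m / (2a)`. -/
def outageSum (L : ℝ → ℝ) (m n : ℕ) (a : ℝ) : ℝ :=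
  ∑ i ∈ Finset.range (n / 2),
    (-1 : ℝ) ^ i * ((m : ℝ) ^ i / ((2 * a) ^ i * (i.factorial : ℝ))) *
      iteratedDeriv i L ((m : ℝ) / (2 * a))

/-! ### Save-then-transmit codes -/

/-- A save-then-transmit code with `m` harvesting slots, `n` transmission slots and `M` messages.
The encoder sees the message and the harvested energies and never spends more energy than was
harvested; the decoder sees the `n` received symbols only. -/
structure Code (m n M : ℕ) where
  encode : Fin M → (Fin m → ℝ) → Fin n → ℝ
  decode : (Fin n → ℝ) → Fin M
  measurable_encode : ∀ w, Measurable (encode w)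
  measurable_decode : Measurable decode
  energy : ∀ (w : Fin M) (z : Fin m → ℝ), (∀ i, 0 ≤ z i) → ∀ k : Fin n,
    ∑ l ∈ Finset.Iic k, encode w z l ^ 2 ≤ ∑ i, z i

/-- Receiver noise: `n` i.i.d. centred Gaussian variables with variance `σ2`. -/
def noise (n : ℕ) (σ2 : ℝ) : Measure (Fin n → ℝ) :=
  Measure.pi fun _ => gaussianReal 0 σ2.toNNReal

/-- Average probability of decoding error `Pr[Ŵ ≠ W]`: the message is uniform, the energy `Z` is
the same in all harvesting slots of the frame, and the received sequence is the transmitted one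
plus Gaussian noise independent of `Z`. -/
def Code.errorProb {m n M : ℕ} (C : Code m n M) {Ω : Type*} [MeasurableSpace Ω] (P : Measure Ω)
    (Z : Ω → ℝ) (σ2 : ℝ) : ℝ :=
  (M : ℝ)⁻¹ * ∑ w : Fin M, (P.prod (noise n σ2)).real
    {q : Ω × (Fin n → ℝ) | C.decode (C.encode w (fun _ => Z q.1) + q.2) ≠ w}

/-- The transmitted sequence for the intended sequence `c` and the harvested energies `z`: the
intended symbol is sent in slot `l` when the harvested energy covers the intended symbols up to
slot `l`, and `0` is sent otherwise. -/
def truncate {m n : ℕ} (c : Fin n → ℝ) (z : Fin m → ℝ) : Fin n → ℝ := fun l =>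
  if ∑ j ∈ Finset.Iic l, c j ^ 2 ≤ ∑ i, z i then c l else 0

theorem measurable_truncate {m n : ℕ} (c : Fin n → ℝ) :
    Measurable (truncate c : (Fin m → ℝ) → Fin n → ℝ) := by
  refine measurable_pi_lambda _ fun l => ?_
  refine Measurable.ite ?_ measurable_const measurable_const
  exact measurableSet_le measurable_const
    (Finset.measurable_sum _ fun i _ => measurable_pi_apply i)

theorem truncate_energy {m n : ℕ} (c : Fin n → ℝ) (z : Fin m → ℝ) (hz : ∀ i, 0 ≤ z i)
    (k : Fin n) : ∑ l ∈ Finset.Iic k, truncate c z l ^ 2 ≤ ∑ i, z i := by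
  classical
  set S : Finset (Fin n) :=
    (Finset.Iic k).filter fun l => ∑ j ∈ Finset.Iic l, c j ^ 2 ≤ ∑ i, z i with hS
  have h1 : ∑ l ∈ Finset.Iic k, truncate c z l ^ 2 = ∑ l ∈ S, c l ^ 2 := by
    rw [hS, Finset.sum_filter]
    refine Finset.sum_congr rfl fun l _ => ?_
    unfold truncate
    split_ifs <;> simp
  rw [h1]
  rcases S.eq_empty_or_nonempty with h | h
  · rw [h, Finset.sum_empty]
    exact Finset.sum_nonneg fun i _ => hz i
  · have hmem := S.max'_mem h
    have h2 : ∑ l ∈ S, c l ^ 2 ≤ ∑ l ∈ Finset.Iic (S.max' h), c l ^ 2 :=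
      Finset.sum_le_sum_of_subset_of_nonneg
        (fun l hl => Finset.mem_Iic.2 (S.le_max' l hl)) fun _ _ _ => sq_nonneg _
    exact h2.trans (Finset.mem_filter.1 hmem).2

/-- The code that transmits the codebook `c` as far as the harvested energy allows. -/
def codebookCode (m : ℕ) {n M : ℕ} (c : Fin M → Fin n → ℝ) (g : (Fin n → ℝ) → Fin M)
    (hg : Measurable g) : Code m n M where
  encode w z := truncate (c w) z
  decode := g
  measurable_encode w := measurable_truncate (c w)
  measurable_decode := hg
  energy w z hz k := truncate_energy (c w) z hz k

/-- The random Gaussian codebook: `M` sequences of `n` symbols, all i.i.d. `𝓝(0, Pt)`. -/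
def gaussianCodebook (M n : ℕ) (Pt : ℝ) : Measure (Fin M → Fin n → ℝ) :=
  Measure.pi fun _ => Measure.pi fun _ => gaussianReal 0 Pt.toNNReal

/-- Average probability of decoding error of the random code that draws its codebook from
`gaussianCodebook M n Pt`, independently of everything else, and decodes with `g c` when the
codebook `c` was drawn. -/
def randomCodeErrorProb (m : ℕ) {n M : ℕ} (g : (Fin M → Fin n → ℝ) → (Fin n → ℝ) → Fin M)
    {Ω : Type*} [MeasurableSpace Ω] (P : Measure Ω) (Z : Ω → ℝ) (Pt σ2 : ℝ) : ℝ :=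
  (M : ℝ)⁻¹ * ∑ w : Fin M, ((gaussianCodebook M n Pt).prod (P.prod (noise n σ2))).real
    {q : (Fin M → Fin n → ℝ) × (Ω × (Fin n → ℝ)) |
      g q.1 (truncate (q.1 w) (fun _ : Fin m => Z q.2.1) + q.2.2) ≠ w}

/-- The rate `R` (nats per channel use of the whole frame of `n + m` slots) is `ε`-achievable at
blocklengths `(m, n)` with i.i.d. `𝓝(0, Pt)` codebooks: for some number `M` of messages with
`log M / (n + m) ≥ R` there is a decoding rule for which the random Gaussian code has average
error probability at most `ε`, and the same holds for some fixed codebook. -/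
def IsAchievable {Ω : Type*} [MeasurableSpace Ω] (P : Measure Ω) (Z : Ω → ℝ) (Pt σ2 : ℝ)
    (m n : ℕ) (ε R : ℝ) : Prop :=
  ∃ M : ℕ, 0 < M ∧ R ≤ Real.log M / ((n : ℝ) + m) ∧
    ∃ (g : (Fin M → Fin n → ℝ) → (Fin n → ℝ) → Fin M)
      (hg : Measurable (Function.uncurry g)),
      randomCodeErrorProb m g P Z Pt σ2 ≤ ε ∧
      ∃ c : Fin M → Fin n → ℝ,
        (codebookCode m c (g c) hg.of_uncurry_left).errorProb P Z σ2 ≤ ε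

/-- The non-asymptotic rate
`(n log(1+γ)/2 - √((2+ε)/ε * γ/(γ+1) * n) - n^(1/4) - 1) / (n + m)`. -/
def rate (ε γ : ℝ) (m n : ℕ) : ℝ :=
  ((n : ℝ) * Real.log (1 + γ) / 2 - Real.sqrt ((2 + ε) / ε * (γ / (γ + 1)) * n)
    - (n : ℝ) ^ (1 / 4 : ℝ) - 1) / ((n : ℝ) + m)

end WirelessPowered

end

open WirelessPowered

namespace WirelessPowered

open Real Set Filter Topology

/-! ### Exponential and Poisson laws -/

/-! Laplace transform. Write $b(y)=1/\ell(\|y\|,\eta)$. Given the locations, a gain contributes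
$\mathbb E[e^{-sbH}]=1/(1+sb)$, so averaging over the fading turns the shot noise into a sum of
$\log(1+sb)$ over the Poisson points (`IsRayleighFading.integral_exp_neg_tsum`). The Poisson Laplace
functional (`IsHomogeneousPPP.laplace_functional`) then gives $\exp(-\lambda\int sb/(1+sb))$. In
polar coordinates the unit disc yields $\pi s/(1+s)$, and the substitution $t=r^{-\eta}$ turns the
exterior into Euler's integral for ${}_2F_1$ (`integral_pathLoss`).

Coding. The decoder looks for a codeword whose information density with the received word exceeds
$T=\frac n2\log(1+\gamma)-\sqrt{K\frac{\gamma}{1+\gamma}n}$, where $K=(2+\epsilon)/\epsilon$. An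
error forces one of three events (`message_error_le`). Outage: the intended codeword costs more than
$mZ$. For even $n$ the chi-square tail at $mZ$ is a Poisson partial sum in $mZ/(2P_{\rm t})$, and
the mean of each term is a derivative of the Laplace transform of $Z$; this is exactly the sum that
the hypothesis bounds by $\epsilon/(2+\epsilon)$. Low density of the sent codeword: the density is a
sum of i.i.d. terms of variance $\gamma/(1+\gamma)$, so Chebyshev's inequality gives
$1/K=\epsilon/(2+\epsilon)$. High density of a wrong codeword: a change of measure gives $e^{-T}$
for each, hence $(M-1)e^{-T}\le e^{-n^{1/4}-1}\le\epsilon^2/(2+\epsilon)$ for $M=\lceil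
e^{T-n^{1/4}-1}\rceil$. The three bounds add up to $\epsilon$. Some fixed codebook does no worse
than the average over the random ones. -/

theorem lintegral_expMeasure_one {f : ℝ → ℝ≥0∞} (hf : Measurable f) :
    ∫⁻ h, f h ∂(expMeasure 1) = ∫⁻ h in Ioi 0, ENNReal.ofReal (exp (-h)) * f h := by
  have hpdf : Measurable (gammaPDF 1 1) := (measurable_gammaPDFReal 1 1).ennreal_ofReal
  rw [expMeasure, gammaMeasure, lintegral_withDensity_eq_lintegral_mul _ hpdf hf,
    ← setLIntegral_univ, ← Iio_union_Ici (a := (0 : ℝ)),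
    lintegral_union measurableSet_Ici (by
      rw [Set.disjoint_left]; intro x hx hx'; exact absurd (mem_Iio.1 hx) (not_lt.2 hx'))]
  have h0 : ∫⁻ h in Iio (0 : ℝ), (gammaPDF 1 1 * f) h = 0 := by
    rw [setLIntegral_congr_fun (g := fun _ => 0) measurableSet_Iio]
    · simp
    · intro h hh
      simp [gammaPDF_of_neg hh]
  rw [h0, zero_add, setLIntegral_congr Ioi_ae_eq_Ici.symm]
  refine setLIntegral_congr_fun measurableSet_Ioi fun h hh => ?_
  have : gammaPDF 1 1 h = ENNReal.ofReal (exp (-h)) := by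
    rw [gammaPDF_of_nonneg (le_of_lt hh)]; simp
  simp [this]

theorem ae_nonneg_expMeasure_one : ∀ᵐ h ∂(expMeasure 1), 0 ≤ h := by
  rw [ae_iff]
  have hm : MeasurableSet {h : ℝ | ¬ 0 ≤ h} := by
    simp only [not_le]; exact measurableSet_Iio
  rw [← lintegral_indicator_one hm, lintegral_expMeasure_one (measurable_one.indicator hm),
    setLIntegral_congr_fun (g := fun _ => 0) measurableSet_Ioi]
  · simp
  · intro h hh
    have : ¬ h < 0 := not_lt.2 (le_of_lt hh)
    simp [this]

theorem lintegral_ofReal_expMeasure_one : ∫⁻ h, ENNReal.ofReal h ∂(expMeasure 1) = 1 := by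
  rw [lintegral_expMeasure_one ENNReal.measurable_ofReal]
  -- The exponent is written as `2 - 1` so that the integral is Euler's integral for $\Gamma(2)=1$.
  have h1 : ∀ h ∈ Ioi (0 : ℝ), ENNReal.ofReal (exp (-h)) * ENNReal.ofReal h =
      ENNReal.ofReal (exp (-h) * h ^ ((2 : ℝ) - 1)) := by
    intro h _
    rw [← ENNReal.ofReal_mul (exp_pos _).le]; norm_num
  rw [setLIntegral_congr_fun measurableSet_Ioi h1,
    ← ofReal_integral_eq_lintegral_ofReal (GammaIntegral_convergent (by norm_num)),
    ← Gamma_eq_integral (by norm_num)]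
  · simp
  · filter_upwards [ae_restrict_mem measurableSet_Ioi] with h hh
    exact mul_nonneg (exp_pos _).le (rpow_nonneg (le_of_lt hh) _)

theorem integral_exp_neg_mul_expMeasure_one {b : ℝ} (hb : 0 ≤ b) :
    ∫ h, exp (-(b * h)) ∂(expMeasure 1) = (1 + b)⁻¹ := by
  rw [integral_eq_lintegral_of_nonneg_ae (ae_of_all _ fun _ => (exp_pos _).le)
    (by fun_prop), lintegral_expMeasure_one (by fun_prop)]
  have h1 : ∀ h ∈ Ioi (0 : ℝ), ENNReal.ofReal (exp (-h)) * ENNReal.ofReal (exp (-(b * h))) =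
      ENNReal.ofReal (exp (-(1 + b) * h)) := by
    intro h _
    rw [← ENNReal.ofReal_mul (exp_pos _).le, ← Real.exp_add]; ring_nf
  have hb1 : -(1 + b) < 0 := by linarith
  rw [setLIntegral_congr_fun measurableSet_Ioi h1, ← integral_eq_lintegral_of_nonneg_ae
    (ae_of_all _ fun _ => (exp_pos _).le) (by fun_prop), integral_exp_mul_Ioi hb1]
  rw [mul_zero, exp_zero, neg_div_neg_eq, one_div]

theorem lintegral_natCast_poissonMeasure (r : NNReal) :
    ∫⁻ n : ℕ, (n : ℝ≥0∞) ∂(poissonMeasure r) = r := by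
  rw [poissonMeasure, lintegral_sum_measure]
  simp only [lintegral_smul_measure, lintegral_dirac, smul_eq_mul]
  have h : ∀ n : ℕ, ENNReal.ofReal (exp (-r) * r ^ (n + 1) / ((n + 1).factorial : ℝ)) *
      ((n + 1 : ℕ) : ℝ≥0∞) = ENNReal.ofReal (r * (exp (-r) * r ^ n / (n.factorial : ℝ))) := by
    intro n
    rw [← ENNReal.ofReal_natCast, ← ENNReal.ofReal_mul (by positivity)]
    congr 1
    rw [Nat.factorial_succ]; push_cast
    field_simp
    ring
  rw [tsum_eq_zero_add' ENNReal.summable]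
  simp only [Nat.cast_zero, mul_zero, zero_add, h]
  have hs := (hasSum_one_poissonMeasure r).mul_left (r : ℝ)
  rw [← ENNReal.ofReal_tsum_of_nonneg (fun n => by positivity) hs.summable, hs.tsum_eq]
  simp

theorem integral_exp_neg_mul_map_poissonMeasure (r : NNReal) (a : ℝ) :
    ∫ t, exp (-(a * t.toReal)) ∂((poissonMeasure r).map (fun j : ℕ => (j : ℝ≥0∞))) =
      exp (-(r * (1 - exp (-a)))) := by
  rw [integral_map (by fun_prop) (by fun_prop), integral_poissonMeasure]
  have h := (NormedSpace.expSeries_div_hasSum_exp (r * exp (-a) : ℝ)).mul_left (exp (-(r : ℝ)))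
  rw [← Real.exp_eq_exp_ℝ] at h
  have h2 : ∀ n : ℕ, (exp (-(r : ℝ)) * r ^ n / (n.factorial : ℝ)) •
      exp (-(a * ((n : ℝ≥0∞)).toReal)) =
      exp (-(r : ℝ)) * ((r * exp (-a)) ^ n / (n.factorial : ℝ)) := by
    intro n
    rw [mul_pow, ← Real.exp_nat_mul, smul_eq_mul, ENNReal.toReal_natCast]
    have : -(a * (n : ℝ)) = n * -a := by ring
    rw [this]; ring
  simp_rw [h2]
  rw [h.tsum_eq, ← Real.exp_add]
  ring_nf

/-! ### The homogeneous Poisson process -/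

section PPP

variable {Ω : Type*} [MeasurableSpace Ω] {P : Measure Ω} {lam : ℝ} {x : ℕ → Ω → Plane}

theorem IsHomogeneousPPP.measurable_pointCount (hx : IsHomogeneousPPP P lam x) {A : Set Plane}
    (hA : MeasurableSet A) : Measurable (pointCount x A) := by
  refine Measurable.tsum fun k => ?_
  exact (measurable_one.indicator hA).comp (hx.measurable k)

/-- The intensity measure of the process is `lam` times Lebesgue measure. -/
theorem IsHomogeneousPPP.sum_map_eq (hx : IsHomogeneousPPP P lam x) (hlam : 0 ≤ lam) :
    Measure.sum (fun k => P.map (x k)) = ENNReal.ofReal lam • (volume : Measure Plane) := by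
  have hbdd : ∀ A : Set Plane, MeasurableSet A → Bornology.IsBounded A →
      Measure.sum (fun k => P.map (x k)) A = (ENNReal.ofReal lam • (volume : Measure Plane)) A := by
    intro A hA hAb
    have h1 : ∫⁻ ω, pointCount x A ω ∂P = ∑' k, P.map (x k) A := by
      unfold pointCount
      rw [lintegral_tsum (f := fun k ω => A.indicator (fun _ => (1 : ℝ≥0∞)) (x k ω)) fun k =>
        ((measurable_one.indicator hA).comp (hx.measurable k)).aemeasurable]
      refine tsum_congr fun k => ?_
      rw [← lintegral_indicator_one hA,
        lintegral_map (measurable_one.indicator hA) (hx.measurable k)]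
      rfl
    rw [Measure.sum_apply _ hA, ← h1]
    have h2 : ∫⁻ ω, pointCount x A ω ∂P = ∫⁻ t, t ∂(P.map (pointCount x A)) := by
      rw [lintegral_map measurable_id' (hx.measurable_pointCount hA)]
    rw [h2, hx.count_law A hA hAb, lintegral_map measurable_id' (measurable_of_countable _),
      lintegral_natCast_poissonMeasure]
    change ENNReal.ofReal _ = _
    rw [ENNReal.ofReal_mul hlam, ENNReal.ofReal_toReal hAb.measure_lt_top.ne]
    rfl
  ext A hA
  -- The law of the counts is known for bounded sets only; exhausting by balls extends the identity
  -- to all measurable sets.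
  have hU : ⋃ n : ℕ, A ∩ Metric.ball 0 n = A := by
    rw [← inter_iUnion, Metric.iUnion_ball_nat, inter_univ]
  have hmono : Monotone fun n : ℕ => A ∩ Metric.ball (0 : Plane) n := fun i j hij =>
    inter_subset_inter_right _ (Metric.ball_subset_ball (by exact_mod_cast hij))
  have h1 := tendsto_measure_iUnion_atTop (μ := Measure.sum (fun k => P.map (x k))) hmono
  have h2 := tendsto_measure_iUnion_atTop
    (μ := ENNReal.ofReal lam • (volume : Measure Plane)) hmono
  rw [hU] at h1 h2
  refine tendsto_nhds_unique h1 (h2.congr fun n => (hbdd _ ?_ ?_).symm)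
  · exact hA.inter measurableSet_ball
  · exact Metric.isBounded_ball.subset inter_subset_right

/-- Campbell's formula. -/
theorem IsHomogeneousPPP.lintegral_tsum (hx : IsHomogeneousPPP P lam x) (hlam : 0 ≤ lam)
    {f : Plane → ℝ≥0∞} (hf : Measurable f) :
    ∫⁻ ω, ∑' k, f (x k ω) ∂P = ENNReal.ofReal lam * ∫⁻ y, f y := by
  rw [MeasureTheory.lintegral_tsum (f := fun k ω => f (x k ω)) fun k =>
    (hf.comp (hx.measurable k)).aemeasurable]
  rw [← smul_eq_mul, ← lintegral_smul_measure, ← hx.sum_map_eq hlam, lintegral_sum_measure]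
  exact tsum_congr fun k => (lintegral_map hf (hx.measurable k)).symm

/-- By Campbell's formula the sum has finite mean. Almost sure convergence is needed because a real
`tsum` takes the value 0 on divergent series, which would break the passages to the limit. -/
theorem IsHomogeneousPPP.ae_summable (hx : IsHomogeneousPPP P lam x) (hlam : 0 ≤ lam)
    {f : Plane → ℝ} (hf : Measurable f) (hf0 : ∀ y, 0 ≤ f y) (hfi : Integrable f) :
    ∀ᵐ ω ∂P, Summable fun k => f (x k ω) := by
  have h : ∫⁻ ω, ∑' k, ENNReal.ofReal (f (x k ω)) ∂P ≠ ∞ := by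
    rw [hx.lintegral_tsum hlam (f := fun y => ENNReal.ofReal (f y)) hf.ennreal_ofReal]
    refine ENNReal.mul_ne_top ENNReal.ofReal_ne_top ?_
    rw [← ofReal_integral_eq_lintegral_ofReal hfi (ae_of_all _ hf0)]
    exact ENNReal.ofReal_ne_top
  have hm : Measurable fun ω => ∑' k, ENNReal.ofReal (f (x k ω)) :=
    Measurable.tsum fun k => (hf.comp (hx.measurable k)).ennreal_ofReal
  filter_upwards [ae_lt_top hm h] with ω hω
  have := ENNReal.summable_toReal hω.ne
  simpa [ENNReal.toReal_ofReal (hf0 _)] using this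

end PPP

/-! ### The Laplace functional of the Poisson process -/

section PPP

variable {Ω : Type*} [MeasurableSpace Ω] {P : Measure Ω} {lam : ℝ} {x : ℕ → Ω → Plane}

theorem IsHomogeneousPPP.ae_pointCount_ne_top (hx : IsHomogeneousPPP P lam x) {A : Set Plane}
    (hA : MeasurableSet A) (hAb : Bornology.IsBounded A) : ∀ᵐ ω ∂P, pointCount x A ω ≠ ∞ := by
  have h : ∀ᵐ t ∂(P.map (pointCount x A)), t ≠ ∞ := by
    rw [hx.count_law A hA hAb, ae_map_iff (measurable_of_countable _).aemeasurable
      (by exact (measurableSet_singleton _).compl)]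
    exact ae_of_all _ fun j => ENNReal.natCast_ne_top j
  exact ae_of_ae_map (hx.measurable_pointCount hA).aemeasurable h

/-- Disjointness leaves at most one nonzero term at each point, so $u\mapsto1-e^{-u}$, which
vanishes at 0, passes through the sum. -/
theorem exp_neg_sum_indicator {α : Type*} {J : ℕ} {A : Fin J → Set α}
    (hd : Pairwise fun i i' => Disjoint (A i) (A i')) (a : Fin J → ℝ) (y : α) :
    1 - exp (-∑ j, (A j).indicator (fun _ => a j) y) =
      ∑ j, (A j).indicator (fun _ => 1 - exp (-(a j))) y := by
  by_cases h : ∃ j, y ∈ A j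
  · obtain ⟨j, hj⟩ := h
    have hne : ∀ i, i ≠ j → y ∉ A i := fun i hi hyi =>
      Set.disjoint_left.1 (hd hi) hyi hj
    rw [Finset.sum_eq_single j (fun i _ hi => by simp [hne i hi]) (by simp),
      Finset.sum_eq_single j (fun i _ hi => by simp [hne i hi]) (by simp)]
    simp [hj]
  · push Not at h
    simp [h]

/-- For a step function the sum over the points is a linear combination of counts of disjoint sets.
Their independence factors the expectation into Laplace transforms of Poisson variables. -/
theorem IsHomogeneousPPP.laplace_step (hx : IsHomogeneousPPP P lam x) (hlam : 0 ≤ lam) {J : ℕ}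
    {A : Fin J → Set Plane} (hA : ∀ i, MeasurableSet (A i))
    (hAb : ∀ i, Bornology.IsBounded (A i)) (hd : Pairwise fun i i' => Disjoint (A i) (A i'))
    (a : Fin J → ℝ) :
    ∫ ω, exp (-∑' k, ∑ j, (A j).indicator (fun _ => a j) (x k ω)) ∂P =
      exp (-(lam * ∫ y, (1 - exp (-∑ j, (A j).indicator (fun _ => a j) y)))) := by
  have h1 : ∀ᵐ ω ∂P, exp (-∑' k, ∑ j, (A j).indicator (fun _ => a j) (x k ω)) =
      ∏ j, exp (-(a j * (pointCount x (A j) ω).toReal)) := by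
    filter_upwards [ae_all_iff.2 fun j => hx.ae_pointCount_ne_top (hA j) (hAb j)] with ω hω
    have hs : ∀ j, HasSum (fun k => (A j).indicator (fun _ => a j) (x k ω))
        (a j * (pointCount x (A j) ω).toReal) := by
      intro j
      have h2 : HasSum (fun k => ((A j).indicator (fun _ => (1 : ℝ≥0∞)) (x k ω)).toReal)
          (pointCount x (A j) ω).toReal := by
        have h3 := ENNReal.summable_toReal (hω j)
        have h4 := h3.hasSum
        rwa [← ENNReal.tsum_toReal_eq (ENNReal.ne_top_of_tsum_ne_top (hω j))] at h4
      refine (h2.mul_left (a j)).congr_fun fun k => ?_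
      by_cases hk : x k ω ∈ A j <;> simp [hk]
    rw [(hasSum_sum fun j _ => hs j).tsum_eq, ← Finset.sum_neg_distrib, Real.exp_sum]
  have hm : ∀ j, Measurable (pointCount x (A j)) := fun j => hx.measurable_pointCount (hA j)
  have hf : ∀ j, Measurable fun t : ℝ≥0∞ => exp (-(a j * t.toReal)) := fun j => by fun_prop
  rw [integral_congr_ae h1, (hx.count_indep J A hA hAb hd).integral_fun_prod_comp
    (f := fun j t => exp (-(a j * t.toReal)))
    (fun j => (hm j).aemeasurable) (fun j => (hf j).aestronglyMeasurable)]
  have h5 : ∀ j, ∫ ω, exp (-(a j * (pointCount x (A j) ω).toReal)) ∂P =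
      exp (-(lam * (volume.real (A j) * (1 - exp (-(a j)))))) := by
    intro j
    rw [← integral_map (f := fun t => exp (-(a j * t.toReal))) (hm j).aemeasurable
      (hf j).aestronglyMeasurable, hx.count_law _ (hA j) (hAb j),
      integral_exp_neg_mul_map_poissonMeasure, Real.coe_toNNReal _ (by positivity), mul_assoc]
    rfl
  simp_rw [h5, exp_neg_sum_indicator hd]
  rw [integral_finsetSum _ fun j _ => (integrable_indicator_iff (hA j)).2
    (integrableOn_const (hAb j).measure_lt_top.ne)]
  rw [← Real.exp_sum, Finset.sum_neg_distrib, Finset.mul_sum]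
  simp_rw [integral_indicator_const _ (hA _), smul_eq_mul]

/-- Step functions $g_n\le f$ converge to $f$, and both sides pass to the limit by dominated
convergence: the left integrand is at most 1, the right one satisfies $1-e^{-g_n}\le g_n\le f$. -/
theorem IsHomogeneousPPP.laplace_functional [IsProbabilityMeasure P]
    (hx : IsHomogeneousPPP P lam x) (hlam : 0 ≤ lam) {f : Plane → ℝ} (hf : Measurable f)
    (hf0 : ∀ y, 0 ≤ f y) {C : ℝ} (hfC : ∀ y, f y ≤ C) (hfi : Integrable f) :
    ∫ ω, exp (-∑' k, f (x k ω)) ∂P = exp (-(lam * ∫ y, (1 - exp (-f y)))) := by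
  -- Level sets of $f$ rounded down to a multiple of $1/n$, cut to the ball of radius $n$ to be
  -- bounded. The bound $f\le C$ leaves finitely many levels; the `+ 1` in `J` includes the level
  -- $\lfloor Cn\rfloor$.
  set A : ℕ → ℕ → Set Plane := fun n j => Metric.ball 0 n ∩ {y | ⌊f y * n⌋₊ = j} with hAdef
  set J : ℕ → ℕ := fun n => ⌊C * n⌋₊ + 1
  set g : ℕ → Plane → ℝ := fun n y =>
    ∑ j : Fin (J n), (A n j).indicator (fun _ => (j : ℝ) / n) y
  have hg : ∀ n y, g n y = (Metric.ball 0 (n : ℝ)).indicator (fun y => (⌊f y * n⌋₊ : ℝ) / n) y := by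
    intro n y
    have hlt : ⌊f y * n⌋₊ < J n := Nat.lt_succ_of_le
      (Nat.floor_mono (mul_le_mul_of_nonneg_right (hfC y) n.cast_nonneg))
    by_cases hy : y ∈ Metric.ball (0 : Plane) (n : ℝ)
    · simp only [g]
      rw [Finset.sum_eq_single (⟨⌊f y * n⌋₊, hlt⟩ : Fin (J n))]
      · rw [indicator_of_mem hy, indicator_of_mem (show y ∈ A n ⌊f y * n⌋₊ from ⟨hy, rfl⟩)]
      · intro j _ hj
        refine indicator_of_notMem (fun h => hj ?_) _
        exact Fin.ext h.2.symm
      · simp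
    · rw [indicator_of_notMem hy]
      exact Finset.sum_eq_zero fun j _ => indicator_of_notMem (fun h => hy h.1) _
  have hg0 : ∀ n y, 0 ≤ g n y := by
    intro n y
    rw [hg]
    exact indicator_nonneg (fun _ _ => by positivity) _
  have hgf : ∀ n y, g n y ≤ f y := by
    intro n y
    rw [hg]
    refine indicator_le' (fun y _ => ?_) (fun y _ => hf0 y) y
    exact div_le_of_le_mul₀ n.cast_nonneg (hf0 y)
      (Nat.floor_le (mul_nonneg (hf0 y) n.cast_nonneg))
  have hglim : ∀ y, Tendsto (fun n => g n y) atTop (𝓝 (f y)) := by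
    intro y
    have h1 : Tendsto (fun n : ℕ => (⌊f y * n⌋₊ : ℝ) / n) atTop (𝓝 (f y)) :=
      (tendsto_nat_floor_mul_div_atTop (hf0 y)).comp tendsto_natCast_atTop_atTop
    refine h1.congr' ?_
    obtain ⟨N, hN⟩ := exists_nat_gt ‖y‖
    filter_upwards [eventually_ge_atTop N] with n hn
    rw [hg, indicator_of_mem]
    rw [mem_ball_zero_iff]
    exact hN.trans_le (by exact_mod_cast hn)
  have hAm : ∀ n j, MeasurableSet (A n j) := by
    intro n j
    refine measurableSet_ball.inter ?_
    exact (Nat.measurable_floor.comp (hf.mul_const _)) (measurableSet_singleton j)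
  have hgm : ∀ n, Measurable (g n) := fun n =>
    Finset.measurable_sum _ fun j _ => measurable_const.indicator (hAm n j)
  have hstep : ∀ n, ∫ ω, exp (-∑' k, g n (x k ω)) ∂P =
      exp (-(lam * ∫ y, (1 - exp (-g n y)))) := by
    intro n
    refine hx.laplace_step hlam (A := fun j : Fin (J n) => A n j) (fun j => hAm n j)
      (fun j => Metric.isBounded_ball.subset inter_subset_left) ?_ _
    intro i j hij
    refine Set.disjoint_left.2 fun y hy hy' => hij (Fin.ext ?_)
    exact hy.2.symm.trans hy'.2
  have hL : Tendsto (fun n => ∫ ω, exp (-∑' k, g n (x k ω)) ∂P) atTop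
      (𝓝 (∫ ω, exp (-∑' k, f (x k ω)) ∂P)) := by
    refine tendsto_integral_of_dominated_convergence (fun _ => 1) ?_ (integrable_const _) ?_ ?_
    · intro n
      refine Measurable.aestronglyMeasurable ?_
      exact measurable_exp.comp
        (Measurable.tsum fun k => (hgm n).comp (hx.measurable k)).neg
    · intro n
      refine ae_of_all _ fun ω => ?_
      rw [norm_of_nonneg (exp_pos _).le, exp_le_one_iff, neg_nonpos]
      exact tsum_nonneg fun k => hg0 n _
    · filter_upwards [hx.ae_summable hlam hf hf0 hfi] with ω hω
      refine (Real.continuous_exp.tendsto _).comp (Tendsto.neg ?_)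
      refine tendsto_tsum_of_dominated_convergence hω (fun k => hglim _) ?_
      refine Eventually.of_forall fun n k => ?_
      rw [norm_of_nonneg (hg0 n _)]
      exact hgf n _
  have hR : Tendsto (fun n => ∫ y, (1 - exp (-g n y))) atTop (𝓝 (∫ y, (1 - exp (-f y)))) := by
    refine tendsto_integral_of_dominated_convergence f ?_ hfi ?_ ?_
    · intro n
      exact (measurable_const.sub (measurable_exp.comp (hgm n).neg)).aestronglyMeasurable
    · intro n
      refine ae_of_all _ fun y => ?_
      have h1 : exp (-g n y) ≤ 1 := exp_le_one_iff.2 (neg_nonpos.2 (hg0 n y))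
      have h2 := add_one_le_exp (-g n y)
      rw [norm_of_nonneg (by linarith)]
      linarith [hgf n y]
    · refine ae_of_all _ fun y => ?_
      exact tendsto_const_nhds.sub ((Real.continuous_exp.tendsto _).comp (hglim y).neg)
  refine tendsto_nhds_unique hL ?_
  simp_rw [hstep]
  exact (Real.continuous_exp.tendsto _).comp (hR.const_mul lam).neg

end PPP

/-! ### Averaging over the fading -/

section Fading

variable {Ω : Type*} [MeasurableSpace Ω] {P : Measure Ω} {lam : ℝ}
  {x : ℕ → Ω → Plane} {H : ℕ → Ω → ℝ}

theorem IsRayleighFading.ae_nonneg (hH : IsRayleighFading P x H) :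
    ∀ᵐ ω ∂P, ∀ k, 0 ≤ H k ω := by
  refine ae_all_iff.2 fun k => ?_
  refine ae_of_ae_map (hH.measurable k).aemeasurable ?_
  rw [hH.law k]
  exact ae_nonneg_expMeasure_one

/-- Since $\mathbb E H_k=1$ and the gains are independent of the locations, the mean of the sum is
the one without fading, which Campbell's formula shows to be finite. -/
theorem IsRayleighFading.ae_summable (hx : IsHomogeneousPPP P lam x)
    (hH : IsRayleighFading P x H) (hlam : 0 ≤ lam) {b : Plane → ℝ} (hb : Measurable b)
    (hb0 : ∀ y, 0 ≤ b y) (hbi : Integrable b) :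
    ∀ᵐ ω ∂P, Summable fun k => H k ω * b (x k ω) := by
  have hm : ∀ k, Measurable fun ω => ENNReal.ofReal (H k ω) * ENNReal.ofReal (b (x k ω)) :=
    fun k => (hH.measurable k).ennreal_ofReal.mul (hb.comp (hx.measurable k)).ennreal_ofReal
  have hE : ∀ k, ∫⁻ ω, ENNReal.ofReal (H k ω) * ENNReal.ofReal (b (x k ω)) ∂P =
      ∫⁻ ω, ENNReal.ofReal (b (x k ω)) ∂P := by
    intro k
    have hind : IndepFun (fun ω => ENNReal.ofReal (H k ω))
        (fun ω => ENNReal.ofReal (b (x k ω))) P :=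
      hH.indep_locations.symm.comp
        (φ := fun h : ℕ → ℝ => ENNReal.ofReal (h k))
        (ψ := fun u : ℕ → Plane => ENNReal.ofReal (b (u k)))
        (measurable_pi_apply k).ennreal_ofReal (hb.comp (measurable_pi_apply k)).ennreal_ofReal
    have h1 := lintegral_mul_eq_lintegral_mul_lintegral_of_indepFun
      (hH.measurable k).ennreal_ofReal (hb.comp (hx.measurable k)).ennreal_ofReal hind
    have h2 : ∫⁻ ω, ENNReal.ofReal (H k ω) ∂P = 1 := by
      rw [← lintegral_ofReal_expMeasure_one, ← hH.law k,
        lintegral_map ENNReal.measurable_ofReal (hH.measurable k)]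
    rw [h2, one_mul] at h1
    exact h1
  have hfin : ∫⁻ ω, ∑' k, ENNReal.ofReal (H k ω) * ENNReal.ofReal (b (x k ω)) ∂P ≠ ∞ := by
    rw [lintegral_tsum fun k => (hm k).aemeasurable]
    simp_rw [hE]
    rw [← lintegral_tsum (f := fun k ω => ENNReal.ofReal (b (x k ω)))
        fun k => ((hb.comp (hx.measurable k)).ennreal_ofReal).aemeasurable,
      hx.lintegral_tsum hlam (f := fun y => ENNReal.ofReal (b y)) hb.ennreal_ofReal]
    refine ENNReal.mul_ne_top ENNReal.ofReal_ne_top ?_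
    rw [← ofReal_integral_eq_lintegral_ofReal hbi (ae_of_all _ hb0)]
    exact ENNReal.ofReal_ne_top
  filter_upwards [ae_lt_top (Measurable.tsum hm) hfin, hH.ae_nonneg] with ω hω hω0
  refine (ENNReal.summable_toReal hω.ne).congr fun k => ?_
  rw [ENNReal.toReal_mul, ENNReal.toReal_ofReal (hω0 k), ENNReal.toReal_ofReal (hb0 _)]

/-- By independence the gains are integrated out first, with the locations frozen. Truncating at $K$
points makes the product formula for independent variables applicable, and the logarithmic form of
the result has the limit needed for the Laplace functional. -/
theorem IsRayleighFading.integral_exp_neg_sum [IsProbabilityMeasure P]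
    (hx : IsHomogeneousPPP P lam x)
    (hH : IsRayleighFading P x H) {b : Plane → ℝ} (hb : Measurable b) (hb0 : ∀ y, 0 ≤ b y)
    {s : ℝ} (hs : 0 ≤ s) (K : ℕ) :
    ∫ ω, exp (-(s * ∑ k : Fin K, H k ω * b (x k ω))) ∂P =
      ∫ ω, exp (-∑ k : Fin K, log (1 + s * b (x k ω))) ∂P := by
  have hX : Measurable fun ω k => x k ω := measurable_pi_lambda _ hx.measurable
  have hY : Measurable fun ω k => H k ω := measurable_pi_lambda _ hH.measurable
  set F : (ℕ → Plane) × (ℕ → ℝ) → ℝ := fun p => exp (-(s * ∑ k : Fin K, p.2 k * b (p.1 k)))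
  have hF : Measurable F := by fun_prop
  have hlaw := (indepFun_iff_map_prod_eq_prod_map_map hX.aemeasurable hY.aemeasurable).1
    hH.indep_locations
  have : IsProbabilityMeasure (P.map fun ω k => x k ω) :=
    Measure.isProbabilityMeasure_map hX.aemeasurable
  have : IsProbabilityMeasure (P.map fun ω k => H k ω) :=
    Measure.isProbabilityMeasure_map hY.aemeasurable
  -- `F` is bounded only for nonnegative gains, so the integrability required by Fubini's theorem
  -- has to discard a null set.
  have hYnn : ∀ᵐ h ∂(P.map fun ω k => H k ω), ∀ k, 0 ≤ h k := by
    rw [ae_map_iff hY.aemeasurable]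
    · exact hH.ae_nonneg
    · have : {h : ℕ → ℝ | ∀ k, 0 ≤ h k} = ⋂ k, {h | 0 ≤ h k} := by ext; simp
      rw [this]
      exact MeasurableSet.iInter fun k => measurableSet_le measurable_const (measurable_pi_apply k)
  have hFi : Integrable F ((P.map fun ω k => x k ω).prod (P.map fun ω k => H k ω)) := by
    refine Integrable.of_bound hF.aestronglyMeasurable 1 ?_
    filter_upwards [Measure.quasiMeasurePreserving_snd.ae hYnn] with p hp
    rw [norm_of_nonneg (exp_pos _).le, exp_le_one_iff, neg_nonpos]
    exact mul_nonneg hs (Finset.sum_nonneg fun k _ => mul_nonneg (hp _) (hb0 _))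
  calc ∫ ω, exp (-(s * ∑ k : Fin K, H k ω * b (x k ω))) ∂P
      = ∫ p, F p ∂(P.map fun ω => ((fun k => x k ω), fun k => H k ω)) := by
        rw [integral_map (hX.prodMk hY).aemeasurable hF.aestronglyMeasurable]
    _ = ∫ u, ∫ h, F (u, h) ∂(P.map fun ω k => H k ω) ∂(P.map fun ω k => x k ω) := by
        rw [hlaw, integral_prod _ hFi]
    _ = ∫ u, exp (-∑ k : Fin K, log (1 + s * b (u k))) ∂(P.map fun ω k => x k ω) := by
        refine integral_congr_ae (ae_of_all _ fun u => ?_)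
        dsimp only
        rw [integral_map (f := fun h => F (u, h)) hY.aemeasurable
          (hF.comp measurable_prodMk_left).aestronglyMeasurable]
        have h1 : ∀ ω, F (u, fun k => H k ω) = ∏ k : Fin K, exp (-(s * b (u k) * H k ω)) := by
          intro ω
          simp only [F]
          rw [← Real.exp_sum, Finset.sum_neg_distrib, Finset.mul_sum]
          congr 2
          exact Finset.sum_congr rfl fun k _ => by ring
        simp_rw [h1]
        have hmk : ∀ k : Fin K, Measurable fun h : ℝ => exp (-(s * b (u k) * h)) :=
          fun k => by fun_prop
        have hind : iIndepFun (fun k : Fin K => H k) P := hH.indep.precomp Fin.val_injective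
        rw [hind.integral_fun_prod_comp (f := fun (k : Fin K) h => exp (-(s * b (u k) * h)))
          (fun k => (hH.measurable k).aemeasurable) (fun k => (hmk k).aestronglyMeasurable)]
        rw [← Finset.sum_neg_distrib, Real.exp_sum]
        refine Finset.prod_congr rfl fun k _ => ?_
        rw [← integral_map (f := fun h => exp (-(s * b (u k) * h)))
          (hH.measurable k).aemeasurable (hmk k).aestronglyMeasurable, hH.law,
          integral_exp_neg_mul_expMeasure_one (mul_nonneg hs (hb0 _)), Real.exp_neg,
          Real.exp_log (by have := mul_nonneg hs (hb0 (u k)); linarith)]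
    _ = _ := by
        rw [integral_map hX.aemeasurable]
        exact Measurable.aestronglyMeasurable (by fun_prop)

theorem IsRayleighFading.integral_exp_neg_tsum [IsProbabilityMeasure P]
    (hx : IsHomogeneousPPP P lam x)
    (hH : IsRayleighFading P x H) (hlam : 0 ≤ lam) {b : Plane → ℝ} (hb : Measurable b)
    (hb0 : ∀ y, 0 ≤ b y) (hbi : Integrable b) {s : ℝ} (hs : 0 ≤ s) :
    ∫ ω, exp (-(s * ∑' k, H k ω * b (x k ω))) ∂P =
      ∫ ω, exp (-∑' k, log (1 + s * b (x k ω))) ∂P := by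
  have hsb : ∀ y, 0 ≤ s * b y := fun y => mul_nonneg hs (hb0 y)
  have hxm := hx.measurable
  have hHm := hH.measurable
  have h1 : Tendsto (fun K : ℕ => ∫ ω, exp (-(s * ∑ k : Fin K, H k ω * b (x k ω))) ∂P) atTop
      (𝓝 (∫ ω, exp (-(s * ∑' k, H k ω * b (x k ω))) ∂P)) := by
    refine tendsto_integral_of_dominated_convergence (fun _ => 1) ?_ (integrable_const _) ?_ ?_
    · exact fun K => Measurable.aestronglyMeasurable (by fun_prop)
    · intro K
      filter_upwards [hH.ae_nonneg] with ω hω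
      rw [norm_of_nonneg (exp_pos _).le, exp_le_one_iff, neg_nonpos]
      exact mul_nonneg hs (Finset.sum_nonneg fun k _ => mul_nonneg (hω _) (hb0 _))
    · filter_upwards [hH.ae_summable hx hlam hb hb0 hbi] with ω hω
      refine (Real.continuous_exp.tendsto _).comp (Tendsto.neg (Tendsto.const_mul s ?_))
      refine hω.hasSum.tendsto_sum_nat.congr fun K => ?_
      rw [Finset.sum_range]
  have h2 : Tendsto (fun K : ℕ => ∫ ω, exp (-∑ k : Fin K, log (1 + s * b (x k ω))) ∂P) atTop
      (𝓝 (∫ ω, exp (-∑' k, log (1 + s * b (x k ω))) ∂P)) := by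
    refine tendsto_integral_of_dominated_convergence (fun _ => 1) ?_ (integrable_const _) ?_ ?_
    · exact fun K => Measurable.aestronglyMeasurable (by fun_prop)
    · intro K
      refine ae_of_all _ fun ω => ?_
      rw [norm_of_nonneg (exp_pos _).le, exp_le_one_iff, neg_nonpos]
      exact Finset.sum_nonneg fun k _ => log_nonneg (by linarith [hsb (x k ω)])
    · filter_upwards [hx.ae_summable hlam hb hb0 hbi] with ω hω
      refine (Real.continuous_exp.tendsto _).comp (Tendsto.neg ?_)
      have hsum : Summable fun k => log (1 + s * b (x k ω)) := by
        refine Summable.of_nonneg_of_le (fun k => log_nonneg (by linarith [hsb (x k ω)]))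
          (fun k => ?_) (hω.mul_left s)
        have := log_le_sub_one_of_pos (x := 1 + s * b (x k ω)) (by linarith [hsb (x k ω)])
        linarith
      refine hsum.hasSum.tendsto_sum_nat.congr fun K => ?_
      rw [Finset.sum_range]
  refine tendsto_nhds_unique h1 (h2.congr fun K => ?_)
  exact (hH.integral_exp_neg_sum hx hb hb0 hs K).symm

theorem IsRayleighFading.laplace_shotNoise [IsProbabilityMeasure P]
    (hx : IsHomogeneousPPP P lam x)
    (hH : IsRayleighFading P x H) (hlam : 0 ≤ lam) {b : Plane → ℝ} (hb : Measurable b)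
    (hb0 : ∀ y, 0 ≤ b y) (hb1 : ∀ y, b y ≤ 1) (hbi : Integrable b) {s : ℝ} (hs : 0 ≤ s) :
    ∫ ω, exp (-(s * ∑' k, H k ω * b (x k ω))) ∂P =
      exp (-(lam * ∫ y, s * b y / (1 + s * b y))) := by
  have hsb : ∀ y, 0 ≤ s * b y := fun y => mul_nonneg hs (hb0 y)
  have hlog : ∀ y, log (1 + s * b y) ≤ s * b y := fun y => by
    have := log_le_sub_one_of_pos (x := 1 + s * b y) (by linarith [hsb y])
    linarith
  have hl0 : ∀ y, 0 ≤ log (1 + s * b y) := fun y => log_nonneg (by linarith [hsb y])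
  have hm : Measurable fun y => log (1 + s * b y) := by fun_prop
  rw [hH.integral_exp_neg_tsum hx hlam hb hb0 hbi hs,
    hx.laplace_functional hlam (f := fun y => log (1 + s * b y)) hm hl0 (C := s)
      (fun y => (hlog y).trans (mul_le_of_le_one_right hs (hb1 y)))
      ((hbi.const_mul s).mono' hm.aestronglyMeasurable
        (ae_of_all _ fun y => by rw [norm_of_nonneg (hl0 y)]; exact hlog y))]
  congr 3
  refine integral_congr_ae (ae_of_all _ fun y => ?_)
  have hpos : 0 < 1 + s * b y := by linarith [hsb y]
  dsimp only
  rw [Real.exp_neg, Real.exp_log hpos]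
  field_simp
  ring

end Fading

/-! ### The path-loss integral -/

theorem pathLoss_pos (r η : ℝ) : 0 < pathLoss r η := lt_max_of_lt_left one_pos

theorem measurable_inv_pathLoss_norm (η : ℝ) :
    Measurable fun y : Plane => (pathLoss ‖y‖ η)⁻¹ := by
  unfold pathLoss
  fun_prop

theorem inv_pathLoss_le_one (r η : ℝ) : (pathLoss r η)⁻¹ ≤ 1 :=
  inv_le_one_of_one_le₀ (le_max_left _ _)

/-- Comparison with $(1+\|y\|)^{-\eta}$, integrable because $\eta$ exceeds the dimension 2; the
constant $2^\eta$ comes from $1+r\le2\max(1,r)$. -/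
theorem integrable_inv_pathLoss_norm {η : ℝ} (hη : 2 < η) :
    Integrable fun y : Plane => (pathLoss ‖y‖ η)⁻¹ := by
  have h1 : Integrable fun y : Plane => (1 + ‖y‖) ^ (-η) :=
    integrable_one_add_norm (by simpa using hη)
  refine (h1.const_mul (2 ^ η)).mono' (measurable_inv_pathLoss_norm η).aestronglyMeasurable
    (ae_of_all _ fun y => ?_)
  rw [norm_of_nonneg (inv_nonneg.2 (pathLoss_pos _ _).le), rpow_neg (by positivity),
    ← div_eq_mul_inv, inv_le_comm₀ (pathLoss_pos _ _) (by positivity), inv_div,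
    div_le_iff₀ (by positivity)]
  have h0 : (0 : ℝ) ≤ η := by linarith
  have hy := norm_nonneg y
  have h2 : (1 + ‖y‖) ^ η ≤ (2 * max 1 ‖y‖) ^ η := by
    refine rpow_le_rpow (by positivity) ?_ h0
    linarith [le_max_left 1 ‖y‖, le_max_right 1 ‖y‖]
  rw [mul_rpow (by norm_num) (by positivity), mul_comm] at h2
  refine h2.trans (mul_le_mul_of_nonneg_right ?_ (by positivity))
  unfold pathLoss
  rcases le_total 1 ‖y‖ with h | h
  · rw [max_eq_right h]; exact le_max_right _ _
  · rw [max_eq_left h, one_rpow]; exact le_max_left _ _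

/-- Here $c=b+1$ with $b=1-2/\eta$, so the factor $(1-t)^{c-b-1}$ in Euler's integral is 1 and the
Gamma quotient is $b=(\eta-2)/\eta$, which cancels the denominator $\eta-2$. -/
theorem calF_eq {η : ℝ} (hη : 2 < η) (s : ℝ) :
    calF s η = 2 / η * ∫ t in Ioo (0 : ℝ) 1, t ^ (-(2 / η)) * (s / (1 + s * t)) := by
  have hη0 : 0 < η := by linarith
  have hb : 0 < 1 - 2 / η := by
    rw [sub_pos, div_lt_one hη0]; exact hη
  have hG : Gamma (2 - 2 / η) = (1 - 2 / η) * Gamma (1 - 2 / η) := by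
    rw [← Gamma_add_one hb.ne']; ring_nf
  have hI : ∫ t in (0 : ℝ)..1, t ^ (1 - 2 / η - 1) * (1 - t) ^ (2 - 2 / η - (1 - 2 / η) - 1) *
      (1 - -s * t) ^ (-(1 : ℝ)) = ∫ t in Ioo (0 : ℝ) 1, t ^ (-(2 / η)) * (1 / (1 + s * t)) := by
    rw [intervalIntegral.integral_of_le zero_le_one, integral_Ioc_eq_integral_Ioo]
    refine setIntegral_congr_fun measurableSet_Ioo fun t _ => ?_
    have e1 : 1 - 2 / η - 1 = -(2 / η) := by ring
    have e2 : 2 - 2 / η - (1 - 2 / η) - 1 = 0 := by ring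
    simp only [e1, e2, rpow_zero, mul_one, neg_mul, sub_neg_eq_add, one_div, rpow_neg_one]
  have hJ : ∫ t in Ioo (0 : ℝ) 1, t ^ (-(2 / η)) * (s / (1 + s * t)) =
      s * ∫ t in Ioo (0 : ℝ) 1, t ^ (-(2 / η)) * (1 / (1 + s * t)) := by
    rw [← integral_const_mul]
    congr 1 with t
    ring
  have e3 : 2 - 2 / η - (1 - 2 / η) = 1 := by ring
  have hG0 := (Gamma_pos_of_pos hb).ne'
  rw [hJ, calF, hyp2F1, hI, hG, e3, Gamma_one]
  have hη2 : η - 2 ≠ 0 := by linarith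
  generalize Gamma (1 - 2 / η) = G at hG0
  generalize ∫ t in Ioo (0 : ℝ) 1, t ^ (-(2 / η)) * (1 / (1 + s * t)) = I
  field_simp

theorem integral_Ioi_one_pathLoss {η : ℝ} (hη : 2 < η) (s : ℝ) :
    ∫ r in Ioi (1 : ℝ), r * (s * (pathLoss r η)⁻¹ / (1 + s * (pathLoss r η)⁻¹)) =
      1 / η * ∫ t in Ioo (0 : ℝ) 1, t ^ (-(2 / η)) * (s / (1 + s * t)) := by
  have hη0 : 0 < η := by linarith
  set φ : ℝ → ℝ := fun t => t ^ (-(2 / η)) * (s / (1 + s * t)) with hφ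
  -- The substitution $t=r^{-\eta}$ acts on the whole half-line, so both domains are encoded by
  -- indicators: $r>1$ corresponds to $t<1$.
  have hsub := integral_comp_rpow_Ioi ((Ioo (0 : ℝ) 1).indicator φ) (p := -η) (by linarith)
  rw [setIntegral_indicator measurableSet_Ioo,
    inter_eq_self_of_subset_right Ioo_subset_Ioi_self] at hsub
  rw [← hsub, ← integral_const_mul]
  have hres : ∫ r in Ioi (1 : ℝ), r * (s * (pathLoss r η)⁻¹ / (1 + s * (pathLoss r η)⁻¹)) =
      ∫ r in Ioi (0 : ℝ), (Ioi (1 : ℝ)).indicator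
        (fun r => r * (s * (pathLoss r η)⁻¹ / (1 + s * (pathLoss r η)⁻¹))) r := by
    rw [setIntegral_indicator measurableSet_Ioi,
      inter_eq_self_of_subset_right (Ioi_subset_Ioi zero_le_one)]
  rw [hres]
  refine setIntegral_congr_fun measurableSet_Ioi fun r hr => ?_
  have hr0 : 0 < r := hr
  by_cases h1 : 1 < r
  · have hmem : r ^ (-η) ∈ Ioo (0 : ℝ) 1 :=
      ⟨rpow_pos_of_pos hr0 _, rpow_lt_one_of_one_lt_of_neg h1 (by linarith)⟩
    rw [indicator_of_mem (mem_Ioi.2 h1), indicator_of_mem hmem]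
    have hl : (pathLoss r η)⁻¹ = r ^ (-η) := by
      rw [pathLoss, max_eq_right (one_le_rpow h1.le hη0.le), rpow_neg hr0.le]
    have hp : r ^ (-η - 1) * (r ^ (-η)) ^ (-(2 / η)) = r ^ (-η) * r := by
      rw [← rpow_mul hr0.le, ← rpow_add hr0]
      rw [← rpow_add_one hr0.ne']
      congr 1
      field_simp
      ring
    rw [hl, hφ, abs_neg, abs_of_pos hη0, smul_eq_mul]
    calc r * (s * r ^ (-η) / (1 + s * r ^ (-η)))
        = (r ^ (-η) * r) * (s / (1 + s * r ^ (-η))) := by ring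
      _ = (1 / η * η) * (r ^ (-η - 1) * (r ^ (-η)) ^ (-(2 / η))) * (s / (1 + s * r ^ (-η))) := by
        rw [hp, one_div_mul_cancel hη0.ne', one_mul]
      _ = _ := by ring
  · have hnot : r ^ (-η) ∉ Ioo (0 : ℝ) 1 := fun h =>
      not_lt.2 (one_le_rpow_of_pos_of_le_one_of_nonpos hr0 (not_lt.1 h1) (by linarith)) h.2
    rw [indicator_of_notMem (show r ∉ Ioi (1 : ℝ) from h1), indicator_of_notMem hnot]
    simp

theorem integral_pathLoss {η : ℝ} (hη : 2 < η) {s : ℝ} (hs : 0 ≤ s) :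
    ∫ y : Plane, s * (pathLoss ‖y‖ η)⁻¹ / (1 + s * (pathLoss ‖y‖ η)⁻¹) =
      π * (s / (1 + s)) + π * calF s η := by
  set φ : ℝ → ℝ := fun r => s * (pathLoss r η)⁻¹ / (1 + s * (pathLoss r η)⁻¹) with hφ
  have hφm : Measurable φ := by
    unfold φ pathLoss
    fun_prop
  have hint : Integrable fun y : Plane => φ ‖y‖ := by
    refine ((integrable_inv_pathLoss_norm hη).const_mul s).mono'
      (hφm.comp measurable_norm).aestronglyMeasurable (ae_of_all _ fun y => ?_)
    have h1 : 0 ≤ s * (pathLoss ‖y‖ η)⁻¹ := mul_nonneg hs (inv_nonneg.2 (pathLoss_pos _ _).le)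
    rw [norm_of_nonneg (by positivity)]
    exact div_le_self h1 (by linarith)
  have hio : IntegrableOn (fun r => r * φ r) (Ioi 0) := by
    have := (integrable_fun_norm_addHaar (volume : Measure Plane) (f := φ)).1 hint
    simpa using this
  have hball : (volume : Measure Plane).real (Metric.ball 0 1) = π := by
    rw [measureReal_def, EuclideanSpace.volume_ball_fin_two]
    simp [pi_nonneg]
  have hrad := integral_fun_norm_addHaar (volume : Measure Plane) φ
  rw [hball] at hrad
  simp only [finrank_euclideanSpace, Fintype.card_fin, Nat.add_one_sub_one, pow_one, smul_eq_mul,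
    nsmul_eq_mul, Nat.cast_ofNat] at hrad
  have hsplit : ∫ r in Ioi (0 : ℝ), r * φ r =
      1 / 2 * (s / (1 + s)) + ∫ r in Ioi (1 : ℝ), r * φ r := by
    rw [← Ioc_union_Ioi_eq_Ioi (zero_le_one (α := ℝ)),
      setIntegral_union Ioc_disjoint_Ioi_same measurableSet_Ioi
        (hio.mono_set Ioc_subset_Ioi_self) (hio.mono_set (Ioi_subset_Ioi zero_le_one))]
    congr 1
    have h1 : ∀ r ∈ Ioc (0 : ℝ) 1, r * φ r = r * (s / (1 + s)) := by
      intro r hr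
      have : pathLoss r η = 1 := max_eq_left (rpow_le_one hr.1.le hr.2 (by linarith))
      simp [hφ, this]
    rw [setIntegral_congr_fun measurableSet_Ioc h1, ← intervalIntegral.integral_of_le zero_le_one,
      intervalIntegral.integral_mul_const, integral_id]
    norm_num
  rw [hrad, hsplit, integral_Ioi_one_pathLoss hη, calF_eq hη]
  ring

/-! ### The harvested energy -/

section Energy

variable {Ω : Type*} [MeasurableSpace Ω] {P : Measure Ω} {lam : ℝ} {x : ℕ → Ω → Plane}
  {H : ℕ → Ω → ℝ}

theorem laplace_harvestedEnergy [IsProbabilityMeasure P] (hx : IsHomogeneousPPP P lam x)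
    (hH : IsRayleighFading P x H) (hlam : 0 ≤ lam) {η : ℝ} (hη : 2 < η) {PPB mu s : ℝ}
    (hs : 0 ≤ PPB * mu * s) :
    laplace P (harvestedEnergy PPB mu η x H) s = laplaceClosedForm lam η (PPB * mu * s) := by
  have h := hH.laplace_shotNoise hx hlam (measurable_inv_pathLoss_norm η)
    (fun y => inv_nonneg.2 (pathLoss_pos _ _).le) (fun y => inv_pathLoss_le_one _ _)
    (integrable_inv_pathLoss_norm hη) hs
  rw [integral_pathLoss hη hs] at h
  rw [laplaceClosedForm, ← Real.exp_add]
  calc laplace P (harvestedEnergy PPB mu η x H) s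
      = ∫ ω, exp (-(PPB * mu * s * ∑' k, H k ω * (pathLoss ‖x k ω‖ η)⁻¹)) ∂P := by
        unfold laplace harvestedEnergy
        congr 1 with ω
        simp only [div_eq_mul_inv]
        ring_nf
    _ = _ := by
        rw [h]
        ring_nf

/-- The harvested energy has a nonnegative measurable version. -/
theorem exists_measurable_harvestedEnergy (hx : ∀ k, Measurable (x k))
    (hH : IsRayleighFading P x H) {PPB mu : ℝ} (h : 0 ≤ PPB * mu) (η : ℝ) :
    ∃ Z : Ω → ℝ, Measurable Z ∧ (∀ ω, 0 ≤ Z ω) ∧ harvestedEnergy PPB mu η x H =ᵐ[P] Z := by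
  refine ⟨fun ω => PPB * mu * |∑' k, H k ω * (pathLoss ‖x k ω‖ η)⁻¹|, ?_,
    fun ω => by positivity, ?_⟩
  · have : Measurable fun ω => ∑' k, H k ω * (pathLoss ‖x k ω‖ η)⁻¹ :=
      Measurable.tsum fun k => (hH.measurable k).mul
        ((measurable_inv_pathLoss_norm η).comp (hx k))
    fun_prop
  · filter_upwards [hH.ae_nonneg] with ω hω
    rw [harvestedEnergy, abs_of_nonneg]
    · simp only [div_eq_mul_inv]
    · exact tsum_nonneg fun k => mul_nonneg (hω k) (inv_nonneg.2 (pathLoss_pos _ _).le)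

end Energy

/-! ### The chi-square tail -/

theorem pi_gaussianReal_eq_withDensity (n : ℕ) {v : NNReal} (hv : v ≠ 0) :
    (Measure.pi fun _ : Fin n => gaussianReal 0 v) =
      volume.withDensity fun x => ENNReal.ofReal (∏ i, gaussianPDFReal 0 v (x i)) := by
  refine Measure.pi_eq fun s hs => ?_
  rw [withDensity_apply _ (MeasurableSet.univ_pi hs), volume_pi, Measure.restrict_pi_pi,
    ← ofReal_integral_eq_lintegral_ofReal, integral_fintype_prod_eq_prod]
  · rw [ENNReal.ofReal_prod_of_nonneg
      fun i _ => integral_nonneg fun x => gaussianPDFReal_nonneg 0 v x]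
    exact Finset.prod_congr rfl fun i _ => (gaussianReal_apply_eq_integral 0 hv (s i)).symm
  · exact Integrable.fintype_prod fun i => (integrable_gaussianPDFReal 0 v).restrict
  · exact ae_of_all _ fun x => Finset.prod_nonneg fun i _ => gaussianPDFReal_nonneg 0 v _

theorem prod_gaussianPDFReal {n : ℕ} (v : NNReal) (x : Fin n → ℝ) :
    ∏ i, gaussianPDFReal 0 v (x i) =
      ((√(2 * π * v))⁻¹) ^ n * exp (-((∑ i, x i ^ 2) / (2 * v))) := by
  simp only [gaussianPDFReal, sub_zero]
  rw [Finset.prod_mul_distrib, Finset.prod_const, Finset.card_univ, Fintype.card_fin,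
    ← Real.exp_sum, Finset.sum_div, ← Finset.sum_neg_distrib]
  simp only [neg_div]

/-- The derivative of a Poisson weight is a difference of consecutive weights, so the sum
telescopes. -/
theorem hasDerivAt_neg_sum_exp_neg_mul_pow (k : ℕ) (u : ℝ) :
    HasDerivAt (fun u : ℝ => -∑ i ∈ Finset.range (k + 1), exp (-u) * u ^ i / (i.factorial : ℝ))
      (exp (-u) * u ^ k / (k.factorial : ℝ)) u := by
  have he : HasDerivAt (fun u : ℝ => exp (-u)) (-exp (-u)) u := by
    simpa using (hasDerivAt_id u).neg.exp
  induction k with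
  | zero =>
    convert! he.neg using 1
    · ext u
      simp
    · simp
  | succ k ih =>
    have h1 := (he.mul (hasDerivAt_pow (k + 1) u)).div_const ((k + 1).factorial : ℝ)
    have h2 := ih.sub h1
    convert! h2 using 1
    · ext u
      rw [Finset.sum_range_succ]
      simp
      ring
    · rw [Nat.factorial_succ]
      push_cast
      field_simp
      simp

theorem tendsto_neg_sum_exp_neg_mul_pow (k : ℕ) :
    Tendsto (fun u : ℝ => -∑ i ∈ Finset.range k, exp (-u) * u ^ i / (i.factorial : ℝ))
      atTop (𝓝 0) := by
  have : Tendsto (fun u : ℝ => -∑ i ∈ Finset.range k, exp (-u) * u ^ i / (i.factorial : ℝ))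
      atTop (𝓝 (-∑ i ∈ Finset.range k, 0 / (i.factorial : ℝ))) := by
    refine (tendsto_finsetSum _ fun i _ => Tendsto.div_const ?_ _).neg
    simpa [mul_comm] using tendsto_pow_mul_exp_neg_atTop_nhds_zero i
  simpa using this

theorem integral_Ioi_pow_mul_exp_neg_sq {v : ℝ} (hv : 0 < v) (k : ℕ) {t : ℝ} (ht : 0 ≤ t) :
    ∫ r in Ioi (√t), r / v * (exp (-(r ^ 2 / (2 * v))) * (r ^ 2 / (2 * v)) ^ k /
        (k.factorial : ℝ)) =
      ∑ i ∈ Finset.range (k + 1), exp (-(t / (2 * v))) * (t / (2 * v)) ^ i /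
        (i.factorial : ℝ) := by
  set G : ℝ → ℝ := fun u => -∑ i ∈ Finset.range (k + 1), exp (-u) * u ^ i / (i.factorial : ℝ)
  have hu : ∀ r : ℝ, HasDerivAt (fun r : ℝ => r ^ 2 / (2 * v)) (r / v) r := by
    intro r
    convert! (hasDerivAt_pow 2 r).div_const (2 * v) using 1
    field_simp
    norm_num [mul_comm]
  have hd : ∀ r : ℝ, HasDerivAt (fun r => G (r ^ 2 / (2 * v)))
      (r / v * (exp (-(r ^ 2 / (2 * v))) * (r ^ 2 / (2 * v)) ^ k / (k.factorial : ℝ))) r := by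
    intro r
    have := (hasDerivAt_neg_sum_exp_neg_mul_pow k (r ^ 2 / (2 * v))).comp r (hu r)
    exact this.congr_deriv (mul_comm _ _)
  have hlim : Tendsto (fun r : ℝ => G (r ^ 2 / (2 * v))) atTop (𝓝 0) := by
    refine (tendsto_neg_sum_exp_neg_mul_pow (k + 1)).comp ?_
    exact (tendsto_pow_atTop two_ne_zero).atTop_div_const (by positivity)
  rw [integral_Ioi_of_hasDerivAt_of_nonneg' (fun r _ => hd r) (fun r hr => ?_) hlim]
  · simp [G, sq_sqrt ht]
  · have : 0 < r := (sqrt_nonneg t).trans_lt hr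
    positivity

/-- The tail of the chi-square distribution with an even number of degrees of freedom. -/
theorem pi_gaussianReal_real_sum_sq_gt (k : ℕ) {v : NNReal} (hv : v ≠ 0) {t : ℝ} (ht : 0 ≤ t) :
    (Measure.pi fun _ : Fin (2 * (k + 1)) => gaussianReal 0 v).real {x | t < ∑ i, x i ^ 2} =
      ∑ i ∈ Finset.range (k + 1), exp (-(t / (2 * v))) * (t / (2 * v)) ^ i /
        (i.factorial : ℝ) := by
  have hv0 : 0 < (v : ℝ) := by positivity
  set n := 2 * (k + 1) with hn
  set F : ℝ → ℝ := (Ioi (√t)).indicator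
    fun r => ((√(2 * π * v))⁻¹) ^ n * exp (-(r ^ 2 / (2 * v))) with hF
  have hS : MeasurableSet {x : Fin n → ℝ | t < ∑ i, x i ^ 2} :=
    measurableSet_lt measurable_const (by fun_prop)
  have hnorm : ∀ x : EuclideanSpace ℝ (Fin n), ‖x‖ ^ 2 = ∑ i, x i ^ 2 := fun x =>
    EuclideanSpace.real_norm_sq_eq x
  have h1 : (Measure.pi fun _ : Fin n => gaussianReal 0 v).real {x | t < ∑ i, x i ^ 2} =
      ∫ y : EuclideanSpace ℝ (Fin n), F ‖y‖ := by
    rw [← (PiLp.volume_preserving_toLp (Fin n)).integral_comp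
      (MeasurableEquiv.toLp 2 (Fin n → ℝ)).measurableEmbedding, measureReal_def,
      pi_gaussianReal_eq_withDensity n hv, withDensity_apply _ hS,
      ← ofReal_integral_eq_lintegral_ofReal, ENNReal.toReal_ofReal, ← integral_indicator hS]
    · congr 1 with x
      have hx := hnorm (WithLp.toLp 2 x)
      by_cases h : t < ∑ i, x i ^ 2
      · have hmem : ‖WithLp.toLp 2 x‖ ∈ Ioi (√t) := by
          rw [mem_Ioi, sqrt_lt' (lt_of_le_of_ne (norm_nonneg _) ?_), hx]
          · exact h
          · intro h0
            rw [← h0] at hx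
            simp at hx h
            linarith
        rw [indicator_of_mem (show x ∈ {x : Fin n → ℝ | t < ∑ i, x i ^ 2} from h), hF,
          indicator_of_mem hmem, hx, prod_gaussianPDFReal]
      · have hmem : ‖WithLp.toLp 2 x‖ ∉ Ioi (√t) := by
          rw [mem_Ioi, not_lt]
          refine le_sqrt_of_sq_le ?_
          rw [hx]
          exact not_lt.1 h
        rw [indicator_of_notMem (show x ∉ {x : Fin n → ℝ | t < ∑ i, x i ^ 2} from h), hF,
          indicator_of_notMem hmem]
    · exact setIntegral_nonneg hS fun x _ =>
        Finset.prod_nonneg fun i _ => gaussianPDFReal_nonneg 0 v _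
    · exact (Integrable.fintype_prod fun i => integrable_gaussianPDFReal 0 v).restrict
    · exact ae_of_all _ fun x => Finset.prod_nonneg fun i _ => gaussianPDFReal_nonneg 0 v _
  have hball : (volume : Measure (EuclideanSpace ℝ (Fin n))).real (Metric.ball 0 1) =
      π ^ (k + 1) / ((k + 1).factorial : ℝ) := by
    have : Nonempty (Fin n) := ⟨⟨0, by omega⟩⟩
    rw [measureReal_def, InnerProductSpace.volume_ball_of_dim_even (k := k + 1) (by simp [hn])]
    simp only [ENNReal.ofReal_one, one_pow, one_mul]
    exact ENNReal.toReal_ofReal (by positivity)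
  have : Nonempty (Fin n) := ⟨⟨0, by omega⟩⟩
  -- In polar coordinates, with unit ball of volume $\pi^{k+1}/(k+1)!$, the radial density becomes
  -- $\frac rv e^{-u}u^k/k!$ for $u=r^2/(2v)$, whose integral is already known.
  rw [h1, integral_fun_norm_addHaar, hball, ← integral_Ioi_pow_mul_exp_neg_sq hv0 k ht,
    ← smul_assoc]
  simp only [finrank_euclideanSpace, Fintype.card_fin, smul_eq_mul, nsmul_eq_mul]
  have h2 : ∀ r : ℝ, r ^ (n - 1) * F r = (Ioi (√t)).indicator
      (fun r => r ^ (n - 1) * (((√(2 * π * v))⁻¹) ^ n * exp (-(r ^ 2 / (2 * v))))) r := by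
    intro r
    rw [hF]
    by_cases h : r ∈ Ioi (√t) <;> simp [h]
  simp_rw [h2]
  rw [setIntegral_indicator measurableSet_Ioi,
    inter_eq_self_of_subset_right (Ioi_subset_Ioi (sqrt_nonneg t)), ← integral_const_mul]
  refine setIntegral_congr_fun measurableSet_Ioi fun r _ => ?_
  have h3 : n - 1 = 2 * k + 1 := by omega
  have h4 : ((√(2 * π * v))⁻¹) ^ n = ((2 * π * v)⁻¹) ^ (k + 1) := by
    rw [hn, pow_mul, inv_pow, sq_sqrt (by positivity)]
  rw [h3, h4, hn, Nat.factorial_succ]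
  push_cast
  rw [div_pow, inv_pow, mul_pow, mul_pow]
  field_simp
  ring

/-! ### The outage probability -/

section Outage

variable {Ω : Type*} [MeasurableSpace Ω] {P : Measure Ω} [IsProbabilityMeasure P] {Z : Ω → ℝ}

/-- For $Z\ge0$ and $u<0$ the variable $e^{uZ}$ is bounded by 1. This is what permits
differentiating the Laplace transform under the expectation at every positive argument. -/
theorem mem_interior_integrableExpSet_of_nonneg (hZ : Measurable Z) (hZ0 : ∀ ω, 0 ≤ Z ω) {s : ℝ}
    (hs : s < 0) : s ∈ interior (integrableExpSet Z P) := by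
  have h : Iio 0 ⊆ integrableExpSet Z P := by
    intro u hu
    refine Integrable.of_bound (by fun_prop) 1 (ae_of_all _ fun ω => ?_)
    rw [norm_of_nonneg (exp_pos _).le, exp_le_one_iff]
    exact mul_nonpos_of_nonpos_of_nonneg (le_of_lt hu) (hZ0 ω)
  exact interior_mono h (by rwa [isOpen_Iio.interior_eq])

theorem iteratedDeriv_laplace (hZ : Measurable Z) (hZ0 : ∀ ω, 0 ≤ Z ω) (i : ℕ) {s : ℝ}
    (hs : 0 < s) :
    iteratedDeriv i (laplace P Z) s = (-1) ^ i * ∫ ω, Z ω ^ i * exp (-(s * Z ω)) ∂P := by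
  have h : laplace P Z = fun s => mgf Z P (-s) := by
    ext s
    simp [laplace, mgf]
  rw [h, iteratedDeriv_comp_neg, iteratedDeriv_mgf
    (mem_interior_integrableExpSet_of_nonneg hZ hZ0 (neg_neg_of_pos hs)), smul_eq_mul]
  simp only [neg_mul]

/-- The probability that a Gaussian sequence needs more energy than is harvested. -/
theorem outageSum_laplace (hZ : Measurable Z) (hZ0 : ∀ ω, 0 ≤ Z ω) {m : ℕ} (hm : 0 < m) (n : ℕ)
    {a : ℝ} (ha : 0 < a) :
    Integrable (fun ω => ∑ i ∈ Finset.range (n / 2), exp (-(m * Z ω / (2 * a))) *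
      (m * Z ω / (2 * a)) ^ i / (i.factorial : ℝ)) P ∧
    outageSum (laplace P Z) m n a = ∫ ω, ∑ i ∈ Finset.range (n / 2),
      exp (-(m * Z ω / (2 * a))) * (m * Z ω / (2 * a)) ^ i / (i.factorial : ℝ) ∂P := by
  have hs : 0 < (m : ℝ) / (2 * a) := by positivity
  have hterm : ∀ (i : ℕ) (ω : Ω), exp (-(m * Z ω / (2 * a))) * (m * Z ω / (2 * a)) ^ i /
      (i.factorial : ℝ) = (m : ℝ) ^ i / ((2 * a) ^ i * (i.factorial : ℝ)) *
        (Z ω ^ i * exp (-(m / (2 * a) * Z ω))) := by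
    intro i ω
    rw [div_pow, mul_pow, mul_div_right_comm (m : ℝ)]
    field_simp
  have hint : ∀ i : ℕ, Integrable (fun ω => exp (-(m * Z ω / (2 * a))) *
      (m * Z ω / (2 * a)) ^ i / (i.factorial : ℝ)) P := by
    intro i
    simp_rw [hterm]
    refine Integrable.const_mul ?_ _
    have := integrable_pow_mul_exp_of_mem_interior_integrableExpSet
      (mem_interior_integrableExpSet_of_nonneg (P := P) hZ hZ0 (neg_neg_of_pos hs)) i
    simpa only [neg_mul] using this
  refine ⟨integrable_finsetSum _ fun i _ => hint i, ?_⟩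
  rw [integral_finsetSum _ fun i _ => hint i, outageSum]
  refine Finset.sum_congr rfl fun i _ => ?_
  simp_rw [hterm]
  rw [integral_const_mul, iteratedDeriv_laplace hZ hZ0 i hs]
  -- The alternating sign of the sum cancels the sign of the $i$-th derivative.
  have : ((-1 : ℝ) ^ i) * (-1) ^ i = 1 := by rw [← mul_pow]; simp
  linear_combination ((m : ℝ) ^ i / ((2 * a) ^ i * (i.factorial : ℝ)) *
    ∫ ω, Z ω ^ i * exp (-(m / (2 * a) * Z ω)) ∂P) * this

/-- Given $Z$ this is a chi-square tail; averaging over $Z$ produces the derivatives of the Laplace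
transform. The unit of energy $q$ drops out, as $Z$ and $P_{\rm t}$ are both divided by it. -/
theorem prod_outage_eq (hZ : Measurable Z) (hZ0 : ∀ ω, 0 ≤ Z ω) {m n : ℕ} (hm : 0 < m)
    (hn : Even n) (hn0 : n ≠ 0) {Pt q : ℝ} (hPt : 0 < Pt) (hq : 0 < q) :
    ((Measure.pi fun _ : Fin n => gaussianReal 0 Pt.toNNReal).prod P).real
      {p | m * Z p.2 < ∑ i, p.1 i ^ 2} =
      outageSum (laplace P fun ω => Z ω / q) m n (Pt / q) := by
  obtain ⟨k, rfl⟩ : ∃ k, n = 2 * (k + 1) := by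
    obtain ⟨j, rfl⟩ := hn
    exact ⟨j - 1, by omega⟩
  have hv : Pt.toNNReal ≠ 0 := by simpa using hPt
  obtain ⟨hi, ho⟩ := outageSum_laplace (P := P) (hZ.div_const q)
    (fun ω => div_nonneg (hZ0 ω) hq.le) hm (2 * (k + 1)) (div_pos hPt hq)
  rw [ho]
  have hS : MeasurableSet {p : (Fin (2 * (k + 1)) → ℝ) × Ω | m * Z p.2 < ∑ i, p.1 i ^ 2} :=
    measurableSet_lt (by fun_prop) (by fun_prop)
  have h0 : ∀ ω, 0 ≤ m * Z ω := fun ω => mul_nonneg m.cast_nonneg (hZ0 ω)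
  have harg : ∀ ω, m * (Z ω / q) / (2 * (Pt / q)) = m * Z ω / (2 * Pt) := by
    intro ω
    field_simp
  have h2 : 2 * (k + 1) / 2 = k + 1 := by omega
  simp only [harg, h2] at hi ⊢
  rw [measureReal_def, Measure.prod_apply_symm hS, integral_eq_lintegral_of_nonneg_ae _ hi.1]
  · congr 1
    refine lintegral_congr fun ω => ?_
    have h3 := pi_gaussianReal_real_sum_sq_gt k hv (h0 ω)
    rw [Real.coe_toNNReal _ hPt.le] at h3
    rw [← h3, ofReal_measureReal]
    rfl
  · refine ae_of_all _ fun ω => Finset.sum_nonneg fun i _ => ?_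
    have := h0 ω
    positivity

end Outage

/-! ### Gaussian moments -/

theorem integrable_pow_gaussianReal (v : NNReal) (k : ℕ) :
    Integrable (fun x : ℝ => x ^ k) (gaussianReal 0 v) := by
  have h : (0 : ℝ) ∈ interior (integrableExpSet id (gaussianReal 0 v)) := by
    rw [integrableExpSet_id_gaussianReal, interior_univ]; trivial
  simpa using integrable_pow_of_mem_interior_integrableExpSet h k

theorem integral_sq_gaussianReal (v : NNReal) : ∫ x, x ^ 2 ∂(gaussianReal 0 v) = v := by
  have h := variance_eq_sub (memLp_id_gaussianReal (μ := 0) (v := v) 2)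
  rw [variance_id_gaussianReal] at h
  simpa [integral_id_gaussianReal] using h.symm

theorem integral_pow_four_gaussianReal (v : NNReal) :
    ∫ x, x ^ 4 ∂(gaussianReal 0 v) = 3 * (v : ℝ) ^ 2 := by
  have h : (0 : ℝ) ∈ interior (integrableExpSet id (gaussianReal 0 v)) := by
    rw [integrableExpSet_id_gaussianReal, interior_univ]; trivial
  have h4 := iteratedDeriv_mgf_zero h 4
  have hm : mgf id (gaussianReal 0 v) = fun t => exp (v * t ^ 2 / 2) := by
    rw [mgf_id_gaussianReal]; simp
  have hE : ∀ t : ℝ, HasDerivAt (fun t : ℝ => exp (v * t ^ 2 / 2))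
      (v * t * exp (v * t ^ 2 / 2)) t := by
    intro t
    have h1 := (((hasDerivAt_pow 2 t).const_mul (v : ℝ)).div_const 2).exp
    refine h1.congr_deriv ?_
    push_cast
    ring
  have h1 : iteratedDeriv 1 (mgf id (gaussianReal 0 v)) = fun t => v * t * exp (v * t ^ 2 / 2) := by
    rw [iteratedDeriv_one, hm]
    exact funext fun t => (hE t).deriv
  have h2 : iteratedDeriv 2 (mgf id (gaussianReal 0 v)) =
      fun t => (v + v ^ 2 * t ^ 2) * exp (v * t ^ 2 / 2) := by
    rw [iteratedDeriv_succ, h1]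
    refine funext fun t => HasDerivAt.deriv ?_
    refine (((hasDerivAt_id t).const_mul (v : ℝ)).mul (hE t)).congr_deriv ?_
    simp only [id]
    ring
  have h3 : iteratedDeriv 3 (mgf id (gaussianReal 0 v)) =
      fun t => (3 * v ^ 2 * t + v ^ 3 * t ^ 3) * exp (v * t ^ 2 / 2) := by
    rw [iteratedDeriv_succ, h2]
    refine funext fun t => HasDerivAt.deriv ?_
    refine ((((hasDerivAt_pow 2 t).const_mul ((v : ℝ) ^ 2)).const_add (v : ℝ)).mul
      (hE t)).congr_deriv ?_
    push_cast
    ring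
  have h5 : iteratedDeriv 4 (mgf id (gaussianReal 0 v)) 0 = 3 * (v : ℝ) ^ 2 := by
    rw [iteratedDeriv_succ, h3]
    refine HasDerivAt.deriv ?_
    refine ((((hasDerivAt_id (0 : ℝ)).const_mul (3 * (v : ℝ) ^ 2)).add
      ((hasDerivAt_pow 3 (0 : ℝ)).const_mul ((v : ℝ) ^ 3))).mul (hE 0)).congr_deriv ?_
    simp
  rw [← h5, h4]
  simp

/-! ### Information density of the Gaussian channel -/

/-- Information density of `𝓝(0, p)` inputs over the channel with noise variance `s`. -/
noncomputable def infoDensity (p s : ℝ) {n : ℕ} (c y : Fin n → ℝ) : ℝ :=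
  ∑ l, (log (1 + p / s) / 2 + (y l ^ 2 / (2 * (p + s)) - (y l - c l) ^ 2 / (2 * s)))

/-- Bayes' rule: the exponential of the information density is the ratio of posterior to prior, and
the posterior of a Gaussian input given the output is Gaussian. -/
theorem gaussianPDFReal_mul_exp_infoDensity {p s : NNReal} (hp : p ≠ 0) (hs : s ≠ 0) (y c : ℝ) :
    gaussianPDFReal 0 p c *
      exp (log (1 + p / s) / 2 + (y ^ 2 / (2 * (p + s)) - (y - c) ^ 2 / (2 * s))) =
      gaussianPDFReal (p * y / (p + s)) (p * s / (p + s)) c := by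
  have hp0 : 0 < (p : ℝ) := by positivity
  have hs0 : 0 < (s : ℝ) := by positivity
  have hsq : exp (log (1 + (p : ℝ) / s) / 2) = √(1 + p / s) := by
    rw [Real.exp_half, Real.exp_log (by positivity)]
  have hnorm : (√(2 * π * p))⁻¹ * √(1 + (p : ℝ) / s) = (√(2 * π * (p * s / (p + s))))⁻¹ := by
    rw [← sqrt_inv, ← sqrt_inv, ← sqrt_mul (by positivity)]
    congr 1
    field_simp
    ring
  simp only [gaussianPDFReal]
  push_cast
  rw [Real.exp_add, hsq, ← hnorm]
  have hexp : exp (-(c - 0) ^ 2 / (2 * (p : ℝ))) *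
      exp (y ^ 2 / (2 * (p + s)) - (y - c) ^ 2 / (2 * (s : ℝ))) =
      exp (-(c - p * y / (p + s)) ^ 2 / (2 * (p * s / (p + s)))) := by
    rw [← Real.exp_add]
    congr 1
    field_simp
    ring
  rw [← hexp]
  ring

theorem lintegral_exp_infoDensity {p s : NNReal} (hp : p ≠ 0) (hs : s ≠ 0) {n : ℕ}
    (y : Fin n → ℝ) :
    ∫⁻ c, ENNReal.ofReal (exp (infoDensity p s c y))
      ∂(Measure.pi fun _ : Fin n => gaussianReal 0 p) = 1 := by
  have hv : p * s / (p + s) ≠ 0 := by positivity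
  set f : Fin n → ℝ → ℝ := fun l c =>
    exp (log (1 + p / s) / 2 + (y l ^ 2 / (2 * (p + s)) - (y l - c) ^ 2 / (2 * s))) with hf
  have hprod : ∀ c : Fin n → ℝ, exp (infoDensity p s c y) = ∏ l, f l (c l) := fun c => by
    rw [infoDensity, Real.exp_sum]
  have hone : ∀ l, ∫⁻ c, ENNReal.ofReal (f l c) ∂(gaussianReal 0 p) = 1 := by
    intro l
    have hfm : Measurable fun c => ENNReal.ofReal (f l c) := by
      simp only [hf]; fun_prop
    rw [gaussianReal_of_var_ne_zero 0 hp,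
      lintegral_withDensity_eq_lintegral_mul _ (measurable_gaussianPDF 0 p) hfm,
      ← lintegral_gaussianPDFReal_eq_one (p * y l / (p + s)) hv]
    refine lintegral_congr fun c => ?_
    rw [← gaussianPDFReal_mul_exp_infoDensity hp hs, Pi.mul_apply, gaussianPDF,
      ENNReal.ofReal_mul (gaussianPDFReal_nonneg 0 p c)]
  have hint : ∀ l, Integrable (f l) (gaussianReal 0 p) := by
    intro l
    refine ⟨Measurable.aestronglyMeasurable (by simp only [hf]; fun_prop), ?_⟩
    rw [hasFiniteIntegral_iff_ofReal (ae_of_all _ fun c => (exp_pos _).le), hone l]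
    exact ENNReal.one_lt_top
  have hone' : ∀ l, ∫ c, f l c ∂(gaussianReal 0 p) = 1 := by
    intro l
    rw [integral_eq_lintegral_of_nonneg_ae (ae_of_all _ fun c => (exp_pos _).le) (hint l).1,
      hone l, ENNReal.toReal_one]
  simp_rw [hprod]
  rw [← ofReal_integral_eq_lintegral_ofReal (Integrable.fintype_prod hint)
    (ae_of_all _ fun c => Finset.prod_nonneg fun l _ => (exp_pos _).le),
    integral_fintype_prod_eq_prod]
  simp [hone']

/-- A codeword drawn independently of the received sequence rarely has a large information
density. -/
theorem pi_gaussianReal_infoDensity_gt_le {p s : NNReal} (hp : p ≠ 0) (hs : s ≠ 0) {n : ℕ}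
    (y : Fin n → ℝ) (T : ℝ) :
    (Measure.pi fun _ : Fin n => gaussianReal 0 p) {c | T < infoDensity p s c y} ≤
      ENNReal.ofReal (exp (-T)) := by
  have hm : Measurable fun c : Fin n → ℝ => ENNReal.ofReal (exp (infoDensity p s c y)) := by
    unfold infoDensity
    fun_prop
  -- Markov's inequality for a variable of mean 1.
  have h := mul_meas_ge_le_lintegral (μ := Measure.pi fun _ : Fin n => gaussianReal 0 p) hm
    (ENNReal.ofReal (exp T))
  rw [lintegral_exp_infoDensity hp hs] at h
  have h2 : (Measure.pi fun _ : Fin n => gaussianReal 0 p) {c | T < infoDensity p s c y} ≤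
      (Measure.pi fun _ : Fin n => gaussianReal 0 p)
        {c | ENNReal.ofReal (exp T) ≤ ENNReal.ofReal (exp (infoDensity p s c y))} :=
    measure_mono fun c hc => ENNReal.ofReal_le_ofReal (exp_le_exp.2 (le_of_lt hc))
  rw [Real.exp_neg, ENNReal.ofReal_inv_of_pos (exp_pos T), ← one_div]
  refine h2.trans ((ENNReal.le_div_iff_mul_le (Or.inl ?_) (Or.inl ENNReal.ofReal_ne_top)).2 ?_)
  · simpa using exp_pos T
  · rwa [mul_comm]

/-- Centred information density of one channel use with input `a` and noise `b`. -/
noncomputable def centredDensity (p s : ℝ) (q : ℝ × ℝ) : ℝ :=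
  (q.1 + q.2) ^ 2 / (2 * (p + s)) - q.2 ^ 2 / (2 * s)

theorem integral_pow_mul_pow_gaussianReal (p s : NNReal) (i j : ℕ) :
    Integrable (fun q : ℝ × ℝ => q.1 ^ i * q.2 ^ j) ((gaussianReal 0 p).prod (gaussianReal 0 s)) ∧
    ∫ q, q.1 ^ i * q.2 ^ j ∂((gaussianReal 0 p).prod (gaussianReal 0 s)) =
      (∫ x, x ^ i ∂(gaussianReal 0 p)) * ∫ x, x ^ j ∂(gaussianReal 0 s) :=
  ⟨(integrable_pow_gaussianReal p i).mul_prod (integrable_pow_gaussianReal s j),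
    integral_prod_mul (fun x : ℝ => x ^ i) (fun x : ℝ => x ^ j)⟩

/-- Integrability travels together with the value, so that polynomial moments are assembled term by
term in one expression. -/
theorem integral_add_eq {α : Type*} [MeasurableSpace α] {μ : Measure α} {f g : α → ℝ} {A B : ℝ}
    (hf : Integrable f μ ∧ ∫ x, f x ∂μ = A) (hg : Integrable g μ ∧ ∫ x, g x ∂μ = B) :
    Integrable (fun x => f x + g x) μ ∧ ∫ x, f x + g x ∂μ = A + B :=
  ⟨hf.1.add hg.1, by rw [integral_add hf.1 hg.1, hf.2, hg.2]⟩

theorem integral_const_mul_eq {α : Type*} [MeasurableSpace α] {μ : Measure α} {f : α → ℝ} {A : ℝ}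
    (r : ℝ) (hf : Integrable f μ ∧ ∫ x, f x ∂μ = A) :
    Integrable (fun x => r * f x) μ ∧ ∫ x, r * f x ∂μ = r * A :=
  ⟨hf.1.const_mul r, by rw [integral_const_mul, hf.2]⟩

theorem integral_centredDensity {p s : NNReal} (hp : p ≠ 0) (hs : s ≠ 0) :
    ∫ q, centredDensity p s q ∂((gaussianReal 0 p).prod (gaussianReal 0 s)) = 0 := by
  have hp0 : 0 < (p : ℝ) := by positivity
  have hs0 : 0 < (s : ℝ) := by positivity
  obtain ⟨i20, e20⟩ := integral_pow_mul_pow_gaussianReal p s 2 0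
  obtain ⟨i11, e11⟩ := integral_pow_mul_pow_gaussianReal p s 1 1
  obtain ⟨i02, e02⟩ := integral_pow_mul_pow_gaussianReal p s 0 2
  have h : ∀ q : ℝ × ℝ, centredDensity p s q = 1 / (2 * (p + s)) * (q.1 ^ 2 * q.2 ^ 0) +
      1 / (p + s) * (q.1 ^ 1 * q.2 ^ 1) + (-(p / (2 * s * (p + s)))) * (q.1 ^ 0 * q.2 ^ 2) := by
    intro q
    rw [centredDensity]
    field_simp
    ring
  simp_rw [h]
  refine (integral_add_eq (integral_add_eq (integral_const_mul_eq _ ⟨i20, e20⟩)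
    (integral_const_mul_eq _ ⟨i11, e11⟩)) (integral_const_mul_eq _ ⟨i02, e02⟩)).2.trans ?_
  simp only [integral_sq_gaussianReal, pow_zero, pow_one, integral_id_gaussianReal,
    integral_const, probReal_univ, smul_eq_mul]
  field_simp
  ring

theorem integral_centredDensity_sq {p s : NNReal} (hp : p ≠ 0) (hs : s ≠ 0) :
    Integrable (fun q => centredDensity p s q ^ 2)
      ((gaussianReal 0 p).prod (gaussianReal 0 s)) ∧
    ∫ q, centredDensity p s q ^ 2 ∂((gaussianReal 0 p).prod (gaussianReal 0 s)) =
      p / (p + s) := by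
  have hp0 : 0 < (p : ℝ) := by positivity
  have hs0 : 0 < (s : ℝ) := by positivity
  obtain ⟨i40, e40⟩ := integral_pow_mul_pow_gaussianReal p s 4 0
  obtain ⟨i22, e22⟩ := integral_pow_mul_pow_gaussianReal p s 2 2
  obtain ⟨i04, e04⟩ := integral_pow_mul_pow_gaussianReal p s 0 4
  obtain ⟨i31, e31⟩ := integral_pow_mul_pow_gaussianReal p s 3 1
  obtain ⟨i13, e13⟩ := integral_pow_mul_pow_gaussianReal p s 1 3
  -- In this expansion the last two terms vanish on integration, since each contains a first moment.
  have h : ∀ q : ℝ × ℝ, centredDensity p s q ^ 2 =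
      1 / (4 * (p + s) ^ 2) * (q.1 ^ 4 * q.2 ^ 0) +
      (2 * s - p) / (2 * s * (p + s) ^ 2) * (q.1 ^ 2 * q.2 ^ 2) +
      p ^ 2 / (4 * s ^ 2 * (p + s) ^ 2) * (q.1 ^ 0 * q.2 ^ 4) +
      1 / (p + s) ^ 2 * (q.1 ^ 3 * q.2 ^ 1) +
      (-(p / (s * (p + s) ^ 2))) * (q.1 ^ 1 * q.2 ^ 3) := by
    intro q
    rw [centredDensity]
    field_simp
    ring
  simp_rw [h]
  have hI := integral_add_eq (integral_add_eq (integral_add_eq (integral_add_eq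
    (integral_const_mul_eq (1 / (4 * ((p : ℝ) + s) ^ 2)) ⟨i40, e40⟩)
    (integral_const_mul_eq ((2 * s - p) / (2 * s * ((p : ℝ) + s) ^ 2)) ⟨i22, e22⟩))
    (integral_const_mul_eq (p ^ 2 / (4 * s ^ 2 * ((p : ℝ) + s) ^ 2)) ⟨i04, e04⟩))
    (integral_const_mul_eq (1 / ((p : ℝ) + s) ^ 2) ⟨i31, e31⟩))
    (integral_const_mul_eq (-(p / (s * ((p : ℝ) + s) ^ 2))) ⟨i13, e13⟩)
  refine ⟨hI.1, hI.2.trans ?_⟩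
  simp only [integral_sq_gaussianReal, integral_pow_four_gaussianReal, pow_zero, pow_one,
    integral_id_gaussianReal, integral_const, probReal_univ, smul_eq_mul]
  field_simp
  ring

theorem infoDensity_add_eq (p s : ℝ) {n : ℕ} (c z : Fin n → ℝ) :
    infoDensity p s c (c + z) =
      n * log (1 + p / s) / 2 + ∑ l, centredDensity p s (c l, z l) := by
  simp only [infoDensity, centredDensity, Pi.add_apply, add_sub_cancel_left]
  rw [Finset.sum_add_distrib, Finset.sum_const, Finset.card_univ, Fintype.card_fin, nsmul_eq_mul]
  ring

theorem measurable_centredDensity (p s : ℝ) : Measurable (centredDensity p s) := by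
  unfold centredDensity
  fun_prop

/-- Chebyshev's inequality for a sum of independent centred variables with the same law. -/
theorem pi_sum_le_neg_sqrt_le {α : Type*} [MeasurableSpace α] {ν : Measure α}
    [IsProbabilityMeasure ν] {ξ : α → ℝ} (hξm : Measurable ξ) {V : ℝ} (hV : 0 < V)
    (h0 : ∫ q, ξ q ∂ν = 0) (h2 : Integrable (fun q => ξ q ^ 2) ν ∧ ∫ q, ξ q ^ 2 ∂ν = V)
    {n : ℕ} (hn : n ≠ 0) {K : ℝ} (hK : 0 < K) :
    (Measure.pi fun _ : Fin n => ν) {q | ∑ l, ξ (q l) ≤ -√(K * V * n)} ≤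
      ENNReal.ofReal (1 / K) := by
  have hn0 : 0 < (n : ℝ) := by positivity
  have hξ : MemLp ξ 2 ν := (memLp_two_iff_integrable_sq hξm.aestronglyMeasurable).2 h2.1
  have hXi : ∀ l : Fin n, MemLp (fun q : Fin n → α => ξ (q l)) 2 (Measure.pi fun _ => ν) :=
    fun l => hξ.comp_measurePreserving (measurePreserving_eval (fun _ : Fin n => ν) l)
  have hX : MemLp (∑ l : Fin n, fun q : Fin n → α => ξ (q l)) 2 (Measure.pi fun _ => ν) :=
    memLp_finsetSum' _ fun l _ => hXi l
  have hmean : ∫ q, (∑ l : Fin n, fun q : Fin n → α => ξ (q l)) q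
      ∂(Measure.pi fun _ : Fin n => ν) = 0 := by
    simp only [Finset.sum_apply]
    rw [integral_finsetSum _ fun l _ => (hXi l).integrable one_le_two]
    refine Finset.sum_eq_zero fun l _ => ?_
    rw [integral_comp_eval (μ := fun _ : Fin n => ν) (f := ξ) hξm.aestronglyMeasurable, h0]
  have hvar : Var[∑ l : Fin n, fun q : Fin n → α => ξ (q l); Measure.pi fun _ : Fin n => ν] =
      n * V := by
    rw [variance_sum_pi (fun _ : Fin n => hξ)]
    have : Var[ξ; ν] = V := by rw [variance_of_integral_eq_zero hξm.aemeasurable h0, ← h2.2]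
    simp [this]
  have hKV : 0 < K * V * n := by positivity
  have hcheb := meas_ge_le_variance_div_sq hX (sqrt_pos.2 hKV)
  have hval : (n : ℝ) * V / (K * V * n) = 1 / K := by
    field_simp
  rw [hmean, hvar, sq_sqrt hKV.le, hval] at hcheb
  refine (measure_mono fun q hq => ?_).trans hcheb
  rw [mem_ofPred_eq] at hq
  rw [mem_ofPred_eq, sub_zero, Finset.sum_apply]
  exact le_abs.2 (Or.inr (by linarith))

/-- The information density of the transmitted sequence is rarely much below its mean. -/
theorem prod_pi_infoDensity_le {p s : NNReal} (hp : p ≠ 0) (hs : s ≠ 0) {n : ℕ} (hn : n ≠ 0)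
    {K : ℝ} (hK : 0 < K) :
    ((Measure.pi fun _ : Fin n => gaussianReal 0 p).prod
      (Measure.pi fun _ : Fin n => gaussianReal 0 s))
      {q | infoDensity p s q.1 (q.1 + q.2) ≤
        n * log (1 + p / s) / 2 - √(K * (p / (p + s)) * n)} ≤ ENNReal.ofReal (1 / K) := by
  have hp0 : 0 < (p : ℝ) := by positivity
  have hs0 : 0 < (s : ℝ) := by positivity
  have hcheb := pi_sum_le_neg_sqrt_le (measurable_centredDensity p s)
    (V := p / (p + s)) (by positivity) (integral_centredDensity hp hs)
    (integral_centredDensity_sq hp hs) hn hK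
  -- A pair of sequences is regrouped as a sequence of independent (input, noise) pairs, the form
  -- that Chebyshev's bound for i.i.d. sums requires.
  have hmp := measurePreserving_arrowProdEquivProdArrow ℝ ℝ (Fin n)
    (fun _ => gaussianReal 0 p) (fun _ => gaussianReal 0 s)
  have hSm : MeasurableSet {q : (Fin n → ℝ) × (Fin n → ℝ) | infoDensity p s q.1 (q.1 + q.2) ≤
      n * log (1 + p / s) / 2 - √(K * (p / (p + s)) * n)} :=
    measurableSet_le (by unfold infoDensity; fun_prop) measurable_const
  rw [← hmp.measure_preimage hSm.nullMeasurableSet]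
  refine (measure_mono fun q hq => ?_).trans hcheb
  simp only [mem_preimage, mem_ofPred_eq, infoDensity_add_eq] at hq
  rw [mem_ofPred_eq]
  change _ + ∑ l, centredDensity p s (q l) ≤ _ at hq
  linarith

/-! ### Threshold decoding -/

instance (n : ℕ) (σ2 : ℝ) : IsProbabilityMeasure (noise n σ2) := by
  unfold noise; infer_instance

instance (M n : ℕ) (Pt : ℝ) : IsProbabilityMeasure (gaussianCodebook M n Pt) := by
  unfold gaussianCodebook; infer_instance

open Classical in
/-- Some index that satisfies `S`, or a default index if there is none. -/
noncomputable def selectIndex {M : ℕ} (hM : 0 < M) (S : Fin M → Prop) : Fin M :=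
  if h : ∃ w, S w then h.choose else ⟨0, hM⟩

/-- Only the candidates that pass the test matter: whichever of them is selected, a wrong output
means that the true index failed or another one passed. -/
theorem selectIndex_ne {M : ℕ} (hM : 0 < M) {S : Fin M → Prop} {w : Fin M}
    (h : selectIndex hM S ≠ w) : ¬ S w ∨ ∃ w', w' ≠ w ∧ S w' := by
  by_cases hw : S w
  · have hex : ∃ w, S w := ⟨w, hw⟩
    rw [selectIndex, dif_pos hex] at h
    exact Or.inr ⟨_, h, hex.choose_spec⟩
  · exact Or.inl hw

/-- Decoder that looks for a codeword whose information density exceeds `T`. -/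
noncomputable def thresholdDecode (p s T : ℝ) {n M : ℕ} (hM : 0 < M) (c : Fin M → Fin n → ℝ)
    (y : Fin n → ℝ) : Fin M :=
  selectIndex hM fun w => T < infoDensity p s (c w) y

/-- The vector of test outcomes lies in a finite discrete space, on which even the arbitrary choice
made by `selectIndex` is measurable. -/
theorem measurable_thresholdDecode (p s T : ℝ) {n M : ℕ} (hM : 0 < M) :
    Measurable (Function.uncurry (thresholdDecode p s T (n := n) hM)) := by
  have h : Measurable fun q : (Fin M → Fin n → ℝ) × (Fin n → ℝ) =>
      fun w => T < infoDensity p s (q.1 w) q.2 := by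
    refine measurable_pi_lambda _ fun w => measurableSet_setOfPred.1 ?_
    exact measurableSet_lt measurable_const (by unfold infoDensity; fun_prop)
  exact (Measurable.of_discrete (f := selectIndex hM)).comp h

theorem truncate_eq_of_le {m n : ℕ} {c : Fin n → ℝ} {z : Fin m → ℝ}
    (h : ∑ j, c j ^ 2 ≤ ∑ i, z i) : truncate c z = c := by
  ext l
  have h1 : ∑ j ∈ Finset.Iic l, c j ^ 2 ≤ ∑ j, c j ^ 2 :=
    Finset.sum_le_sum_of_subset_of_nonneg (Finset.subset_univ _) fun _ _ _ => sq_nonneg _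
  rw [truncate, if_pos (h1.trans h)]

section Congr

variable {Ω : Type*} [MeasurableSpace Ω] {P : Measure Ω}

theorem laplace_congr_ae {Z Z' : Ω → ℝ} (h : Z =ᵐ[P] Z') : laplace P Z = laplace P Z' := by
  ext s
  refine integral_congr_ae ?_
  filter_upwards [h] with ω hω
  rw [hω]

/-- Allows the harvested energy, nonnegative only almost surely, to be replaced by a version that is
nonnegative everywhere. -/
theorem IsAchievable.congr_ae {Z Z' : Ω → ℝ} (h : Z =ᵐ[P] Z') {Pt σ2 ε R : ℝ} {m n : ℕ}
    (hZ : IsAchievable P Z Pt σ2 m n ε R) : IsAchievable P Z' Pt σ2 m n ε R := by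
  obtain ⟨M, hM, hR, g, hg, hrand, c, hc⟩ := hZ
  have h1 : ∀ᵐ q ∂(P.prod (noise n σ2)), Z q.1 = Z' q.1 :=
    Measure.quasiMeasurePreserving_fst.ae h
  have h2 : ∀ᵐ q ∂((gaussianCodebook M n Pt).prod (P.prod (noise n σ2))), Z q.2.1 = Z' q.2.1 :=
    Measure.quasiMeasurePreserving_snd.ae h1
  refine ⟨M, hM, hR, g, hg, le_of_eq_of_le ?_ hrand, c, le_of_eq_of_le ?_ hc⟩
  · unfold randomCodeErrorProb
    congr 1
    refine Finset.sum_congr rfl fun w _ => measureReal_congr ?_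
    filter_upwards [h2] with q hq
    apply propext
    change g q.1 (truncate (q.1 w) (fun _ : Fin m => Z' q.2.1) + q.2.2) ≠ w ↔
      g q.1 (truncate (q.1 w) (fun _ : Fin m => Z q.2.1) + q.2.2) ≠ w
    rw [hq]
  · unfold Code.errorProb
    congr 1
    refine Finset.sum_congr rfl fun w _ => measureReal_congr ?_
    filter_upwards [h1] with q hq
    apply propext
    change g c (truncate (c w) (fun _ : Fin m => Z' q.1) + q.2) ≠ w ↔
      g c (truncate (c w) (fun _ : Fin m => Z q.1) + q.2) ≠ w
    rw [hq]

end Congr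

section Coding

variable {Ω : Type*} [MeasurableSpace Ω] {P : Measure Ω} [IsProbabilityMeasure P]

/-- Distinct codewords are independent. Once the sent codeword and the noise are frozen, the
received word is fixed and the other codeword is a fresh Gaussian sequence. -/
theorem codebook_infoDensity_gt_le {Pt σ2 : ℝ} (hPt : 0 < Pt) (hσ2 : 0 < σ2) {n M : ℕ}
    {w w' : Fin M} (hw : w' ≠ w) (T : ℝ) :
    ((gaussianCodebook M n Pt).prod (P.prod (noise n σ2)))
      {q | T < infoDensity Pt σ2 (q.1 w') (q.1 w + q.2.2)} ≤ ENNReal.ofReal (exp (-T)) := by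
  have hp : Pt.toNNReal ≠ 0 := by simpa using hPt
  have hs : σ2.toNNReal ≠ 0 := by simpa using hσ2
  have hS : MeasurableSet {q : (Fin M → Fin n → ℝ) × (Ω × (Fin n → ℝ)) |
      T < infoDensity Pt σ2 (q.1 w') (q.1 w + q.2.2)} :=
    measurableSet_lt measurable_const (by unfold infoDensity; fun_prop)
  have hpair : (gaussianCodebook M n Pt).map (fun c => (c w', c w)) =
      (Measure.pi fun _ : Fin n => gaussianReal 0 Pt.toNNReal).prod
        (Measure.pi fun _ : Fin n => gaussianReal 0 Pt.toNNReal) := by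
    have hind := (iIndepFun_pi (X := fun (_ : Fin M) (x : Fin n → ℝ) => x)
      (μ := fun _ : Fin M => Measure.pi fun _ : Fin n => gaussianReal 0 Pt.toNNReal)
      fun _ => aemeasurable_id).indepFun hw
    rw [gaussianCodebook, (indepFun_iff_map_prod_eq_prod_map_map
      (measurable_pi_apply w').aemeasurable (measurable_pi_apply w).aemeasurable).1 hind]
    congr 1
    · exact (measurePreserving_eval _ w').map_eq
    · exact (measurePreserving_eval _ w).map_eq
  rw [Measure.prod_apply_symm hS]
  have hle : ∀ r : Ω × (Fin n → ℝ), gaussianCodebook M n Pt ((fun c => (c, r)) ⁻¹'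
      {q | T < infoDensity Pt σ2 (q.1 w') (q.1 w + q.2.2)}) ≤ ENNReal.ofReal (exp (-T)) := by
    intro r
    have hS' : MeasurableSet {u : (Fin n → ℝ) × (Fin n → ℝ) |
        T < infoDensity Pt σ2 u.1 (u.2 + r.2)} :=
      measurableSet_lt measurable_const (by unfold infoDensity; fun_prop)
    have h1 : gaussianCodebook M n Pt ((fun c => (c, r)) ⁻¹'
        {q | T < infoDensity Pt σ2 (q.1 w') (q.1 w + q.2.2)}) =
        (gaussianCodebook M n Pt).map (fun c => (c w', c w))
          {u | T < infoDensity Pt σ2 u.1 (u.2 + r.2)} := by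
      rw [Measure.map_apply (by fun_prop) hS']
      rfl
    rw [h1, hpair, Measure.prod_apply_symm hS']
    refine (lintegral_mono (g := fun _ => ENNReal.ofReal (exp (-T))) fun u => ?_).trans (by simp)
    have := pi_gaussianReal_infoDensity_gt_le hp hs (u + r.2) T
    rwa [Real.coe_toNNReal _ hPt.le, Real.coe_toNNReal _ hσ2.le] at this
  exact (lintegral_mono hle).trans (by simp)

theorem codebook_infoDensity_le {Pt σ2 : ℝ} (hPt : 0 < Pt) (hσ2 : 0 < σ2) {n M : ℕ}
    (hn : n ≠ 0) (w : Fin M) {K : ℝ} (hK : 0 < K) :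
    ((gaussianCodebook M n Pt).prod (P.prod (noise n σ2)))
      {q | infoDensity Pt σ2 (q.1 w) (q.1 w + q.2.2) ≤
        n * log (1 + Pt / σ2) / 2 - √(K * (Pt / (Pt + σ2)) * n)} ≤ ENNReal.ofReal (1 / K) := by
  have hp : Pt.toNNReal ≠ 0 := by simpa using hPt
  have hs : σ2.toNNReal ≠ 0 := by simpa using hσ2
  have hmp : MeasurePreserving (Prod.map (Function.eval w) Prod.snd)
      ((gaussianCodebook M n Pt).prod (P.prod (noise n σ2)))
      ((Measure.pi fun _ : Fin n => gaussianReal 0 Pt.toNNReal).prod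
        (Measure.pi fun _ : Fin n => gaussianReal 0 σ2.toNNReal)) :=
    (measurePreserving_eval (fun _ : Fin M => Measure.pi fun _ : Fin n =>
      gaussianReal 0 Pt.toNNReal) w).prod (measurePreserving_snd (μ := P) (ν := noise n σ2))
  have h := prod_pi_infoDensity_le hp hs hn hK
  rw [Real.coe_toNNReal _ hPt.le, Real.coe_toNNReal _ hσ2.le] at h
  have hS : MeasurableSet {q : (Fin n → ℝ) × (Fin n → ℝ) | infoDensity Pt σ2 q.1 (q.1 + q.2) ≤
      n * log (1 + Pt / σ2) / 2 - √(K * (Pt / (Pt + σ2)) * n)} :=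
    measurableSet_le (by unfold infoDensity; fun_prop) measurable_const
  rw [← hmp.measure_preimage hS.nullMeasurableSet] at h
  exact h

theorem codebook_outage_eq {Z : Ω → ℝ} (hZ : Measurable Z) (hZ0 : ∀ ω, 0 ≤ Z ω) {m n M : ℕ}
    (hm : 0 < m) (hn : Even n) (hn0 : n ≠ 0) {Pt q : ℝ} (hPt : 0 < Pt) (hq : 0 < q) (σ2 : ℝ)
    (w : Fin M) :
    ((gaussianCodebook M n Pt).prod (P.prod (noise n σ2))).real
      {r | m * Z r.2.1 < ∑ i, r.1 w i ^ 2} =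
      outageSum (laplace P fun ω => Z ω / q) m n (Pt / q) := by
  have hmp : MeasurePreserving (Prod.map (Function.eval w) Prod.fst)
      ((gaussianCodebook M n Pt).prod (P.prod (noise n σ2)))
      ((Measure.pi fun _ : Fin n => gaussianReal 0 Pt.toNNReal).prod P) :=
    (measurePreserving_eval (fun _ : Fin M => Measure.pi fun _ : Fin n =>
      gaussianReal 0 Pt.toNNReal) w).prod (measurePreserving_fst (μ := P) (ν := noise n σ2))
  have hS : MeasurableSet {p : (Fin n → ℝ) × Ω | m * Z p.2 < ∑ i, p.1 i ^ 2} :=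
    measurableSet_lt (by fun_prop) (by fun_prop)
  rw [← prod_outage_eq (P := P) hZ hZ0 hm hn hn0 hPt hq, measureReal_def, measureReal_def,
    ← hmp.measure_preimage hS.nullMeasurableSet]
  rfl

/-- Error probability of one message: outage, low information density of the transmitted codeword,
or high information density of another one. -/
theorem message_error_le {Z : Ω → ℝ} (hZ : Measurable Z) (hZ0 : ∀ ω, 0 ≤ Z ω) {m n M : ℕ}
    (hm : 0 < m) (hn : Even n) (hn0 : n ≠ 0) (hM : 0 < M) {Pt σ2 q K T : ℝ} (hPt : 0 < Pt)
    (hσ2 : 0 < σ2) (hq : 0 < q) (hK : 0 < K)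
    (hT : T = n * log (1 + Pt / σ2) / 2 - √(K * (Pt / (Pt + σ2)) * n)) (w : Fin M) :
    ((gaussianCodebook M n Pt).prod (P.prod (noise n σ2))).real
      {r | thresholdDecode Pt σ2 T hM r.1
        (truncate (r.1 w) (fun _ : Fin m => Z r.2.1) + r.2.2) ≠ w} ≤
      outageSum (laplace P fun ω => Z ω / q) m n (Pt / q) + 1 / K + (M - 1) * exp (-T) := by
  set μ := (gaussianCodebook M n Pt).prod (P.prod (noise n σ2))
  set O : Set ((Fin M → Fin n → ℝ) × (Ω × (Fin n → ℝ))) :=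
    {r | m * Z r.2.1 < ∑ i, r.1 w i ^ 2}
  set B : Set ((Fin M → Fin n → ℝ) × (Ω × (Fin n → ℝ))) :=
    {r | infoDensity Pt σ2 (r.1 w) (r.1 w + r.2.2) ≤ T}
  set W : Fin M → Set ((Fin M → Fin n → ℝ) × (Ω × (Fin n → ℝ))) := fun w' =>
    {r | T < infoDensity Pt σ2 (r.1 w') (r.1 w + r.2.2)}
  -- `B` and `W` refer to the untruncated codeword. Outside `O` truncation does nothing, so the
  -- inclusion holds without conditioning on the absence of outage, which would destroy the Gaussian
  -- law of the codeword.
  have hsub : {r : (Fin M → Fin n → ℝ) × (Ω × (Fin n → ℝ)) | thresholdDecode Pt σ2 T hM r.1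
      (truncate (r.1 w) (fun _ : Fin m => Z r.2.1) + r.2.2) ≠ w} ⊆
      (O ∪ B) ∪ ⋃ w' ∈ Finset.univ.erase w, W w' := by
    intro r hr
    by_cases hO : r ∈ O
    · exact Or.inl (Or.inl hO)
    have htr : truncate (r.1 w) (fun _ : Fin m => Z r.2.1) = r.1 w := by
      refine truncate_eq_of_le ?_
      simpa [O] using hO
    have hr' : thresholdDecode Pt σ2 T hM r.1 (r.1 w + r.2.2) ≠ w := by
      have : thresholdDecode Pt σ2 T hM r.1
        (truncate (r.1 w) (fun _ : Fin m => Z r.2.1) + r.2.2) ≠ w := hr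
      rwa [htr] at this
    rcases selectIndex_ne hM hr' with h | ⟨w', hw', h⟩
    · exact Or.inl (Or.inr (not_lt.1 h))
    · refine Or.inr (mem_iUnion₂.2 ⟨w', ?_, h⟩)
      exact Finset.mem_erase.2 ⟨hw', Finset.mem_univ _⟩
  have hO : μ.real O = outageSum (laplace P fun ω => Z ω / q) m n (Pt / q) :=
    codebook_outage_eq hZ hZ0 hm hn hn0 hPt hq σ2 w
  have hB : μ.real B ≤ 1 / K := by
    refine ENNReal.toReal_le_of_le_ofReal (by positivity) ?_
    have := codebook_infoDensity_le (P := P) hPt hσ2 hn0 w hK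
    rw [← hT] at this
    exact this
  have hW : ∀ w' ∈ Finset.univ.erase w, μ.real (W w') ≤ exp (-T) := fun w' hw' =>
    ENNReal.toReal_le_of_le_ofReal (exp_pos _).le
      (codebook_infoDensity_gt_le hPt hσ2 (Finset.ne_of_mem_erase hw') T)
  have hWs : μ.real (⋃ w' ∈ Finset.univ.erase w, W w') ≤ (M - 1) * exp (-T) := by
    refine (measureReal_biUnion_finset_le _ _).trans ((Finset.sum_le_sum hW).trans_eq ?_)
    rw [Finset.sum_const, Finset.card_erase_of_mem (Finset.mem_univ _), Finset.card_univ,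
      Fintype.card_fin, nsmul_eq_mul, Nat.cast_pred hM]
  have h1 := (measureReal_mono (μ := μ) hsub).trans (measureReal_union_le _ _)
  have h2 := measureReal_union_le (μ := μ) O B
  linarith

theorem average_le {M : ℕ} (hM : 0 < M) {f : Fin M → ℝ} {ε : ℝ} (h : ∀ w, f w ≤ ε) :
    (M : ℝ)⁻¹ * ∑ w, f w ≤ ε := by
  have hM0 : (0 : ℝ) < M := by exact_mod_cast hM
  have : ∑ w, f w ≤ M * ε := by
    refine (Finset.sum_le_sum fun w _ => h w).trans_eq ?_
    simp
  calc (M : ℝ)⁻¹ * ∑ w, f w ≤ (M : ℝ)⁻¹ * (M * ε) := by gcongr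
    _ = ε := by field_simp

/-- Some codebook is at least as good as the random code on average. -/
theorem exists_codebook_errorProb_le {Z : Ω → ℝ} (hZ : Measurable Z) (m : ℕ) {n M : ℕ}
    {g : (Fin M → Fin n → ℝ) → (Fin n → ℝ) → Fin M} (hg : Measurable (Function.uncurry g))
    (Pt σ2 : ℝ) :
    ∃ c, (codebookCode m c (g c) hg.of_uncurry_left).errorProb P Z σ2 ≤
      randomCodeErrorProb m g P Z Pt σ2 := by
  set E : Fin M → Set ((Fin M → Fin n → ℝ) × (Ω × (Fin n → ℝ))) := fun w =>
    {q | g q.1 (truncate (q.1 w) (fun _ : Fin m => Z q.2.1) + q.2.2) ≠ w}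
  have hE : ∀ w, MeasurableSet (E w) := by
    intro w
    have ht : Measurable fun q : (Fin M → Fin n → ℝ) × (Ω × (Fin n → ℝ)) =>
        truncate (q.1 w) (fun _ : Fin m => Z q.2.1) := by
      refine measurable_pi_lambda _ fun l => ?_
      refine Measurable.ite (measurableSet_le ?_ ?_) ?_ measurable_const <;> fun_prop
    have hd : Measurable fun q : (Fin M → Fin n → ℝ) × (Ω × (Fin n → ℝ)) =>
        g q.1 (truncate (q.1 w) (fun _ : Fin m => Z q.2.1) + q.2.2) :=
      hg.comp (measurable_fst.prodMk (ht.add (measurable_snd.comp measurable_snd)))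
    exact (measurableSet_singleton w).compl.preimage hd
  have hsm : ∀ w, Measurable fun c => (P.prod (noise n σ2)) (Prod.mk c ⁻¹' E w) := fun w =>
    measurable_measure_prodMk_left (hE w)
  have hint : ∀ w, Integrable (fun c => (P.prod (noise n σ2)).real (Prod.mk c ⁻¹' E w))
      (gaussianCodebook M n Pt) := fun w =>
    Integrable.of_bound (hsm w).ennreal_toReal.aestronglyMeasurable 1
      (ae_of_all _ fun c => by
        rw [norm_of_nonneg measureReal_nonneg]; exact measureReal_le_one)
  have havg : ∫ c, (M : ℝ)⁻¹ * ∑ w, (P.prod (noise n σ2)).real (Prod.mk c ⁻¹' E w)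
      ∂(gaussianCodebook M n Pt) = randomCodeErrorProb m g P Z Pt σ2 := by
    rw [integral_const_mul, integral_finsetSum _ fun w _ => hint w, randomCodeErrorProb]
    congr 1
    refine Finset.sum_congr rfl fun w _ => ?_
    simp only [measureReal_def]
    rw [integral_toReal (hsm w).aemeasurable (ae_of_all _ fun c => measure_lt_top _ _),
      ← Measure.prod_apply (hE w)]
  obtain ⟨c, hc⟩ := exists_le_integral
    ((integrable_finsetSum Finset.univ fun w _ => hint w).const_mul (M : ℝ)⁻¹)
  exact ⟨c, hc.trans_eq havg⟩

theorem IsAchievable.of_measurable {Z : Ω → ℝ} (hZ : Measurable Z) (hZ0 : ∀ ω, 0 ≤ Z ω)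
    {m n : ℕ} (hm : 0 < m) (hn : Even n) {Pt σ2 q ε : ℝ} (hPt : 0 < Pt) (hσ2 : 0 < σ2)
    (hq : 0 < q) (hε : 0 < ε) (hε1 : ε < 1)
    (hout : outageSum (laplace P fun ω => Z ω / q) m n (Pt / q) ≤ ε / (2 + ε))
    (hlog : log ((2 + ε) / ε ^ 2) ^ 4 ≤ (n : ℝ)) :
    IsAchievable P Z Pt σ2 m n ε (rate ε (Pt / σ2) m n) := by
  -- Makes the logarithm positive, so that the blocklength condition excludes $n=0$.
  have hratio : 1 < (2 + ε) / ε ^ 2 := by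
    rw [one_lt_div (by positivity)]
    nlinarith
  have hlog0 : 0 < log ((2 + ε) / ε ^ 2) := log_pos hratio
  have hnpos : (0 : ℝ) < n := (pow_pos hlog0 4).trans_le hlog
  have hn0 : n ≠ 0 := by
    rintro rfl
    simp at hnpos
  -- Chosen so that Chebyshev's bound $1/K$ equals the share $\epsilon/(2+\epsilon)$ allotted to
  -- outage.
  set K : ℝ := (2 + ε) / ε with hK
  have hK0 : 0 < K := by positivity
  set T : ℝ := n * log (1 + Pt / σ2) / 2 - √(K * (Pt / (Pt + σ2)) * n) with hT
  set D : ℝ := T - (n : ℝ) ^ (1 / 4 : ℝ) - 1 with hD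
  -- Rounding up gives $\log M\ge D$, which is the rate, while $M-1\le e^D$ keeps the union bound
  -- over the $M-1$ wrong codewords intact.
  set M : ℕ := ⌈exp D⌉₊ with hMdef
  have hM : 0 < M := Nat.ceil_pos.2 (exp_pos D)
  have hM0 : (0 : ℝ) < M := by exact_mod_cast hM
  have hroot : log ((2 + ε) / ε ^ 2) ≤ (n : ℝ) ^ (1 / 4 : ℝ) := by
    have h := rpow_le_rpow (by positivity) hlog (by norm_num : (0 : ℝ) ≤ 1 / 4)
    rwa [← rpow_natCast, ← rpow_mul hlog0.le, Nat.cast_ofNat,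
      show (4 : ℝ) * (1 / 4) = 1 by norm_num, rpow_one] at h
  have hfalse : ((M : ℝ) - 1) * exp (-T) ≤ ε ^ 2 / (2 + ε) := by
    have h1 : (M : ℝ) - 1 ≤ exp D := by
      linarith [Nat.ceil_lt_add_one (exp_pos D).le]
    calc ((M : ℝ) - 1) * exp (-T) ≤ exp D * exp (-T) := by gcongr
      _ = exp (-(n : ℝ) ^ (1 / 4 : ℝ) - 1) := by
        rw [← Real.exp_add, hD]; ring_nf
      _ ≤ exp (-log ((2 + ε) / ε ^ 2)) := by
        refine exp_le_exp.2 ?_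
        linarith
      _ = ε ^ 2 / (2 + ε) := by
        rw [Real.exp_neg, Real.exp_log (by positivity), inv_div]
  have hrand : randomCodeErrorProb m (thresholdDecode Pt σ2 T (n := n) hM) P Z Pt σ2 ≤ ε := by
    refine average_le hM fun w => ?_
    refine (message_error_le hZ hZ0 hm hn hn0 hM hPt hσ2 hq hK0 hT w).trans ?_
    have h1 : 1 / K = ε / (2 + ε) := by rw [hK, one_div_div]
    have h2 : ε / (2 + ε) + ε / (2 + ε) + ε ^ 2 / (2 + ε) = ε := by
      field_simp
      ring
    linarith
  refine ⟨M, hM, ?_, thresholdDecode Pt σ2 T hM, measurable_thresholdDecode Pt σ2 T hM, hrand, ?_⟩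
  · rw [rate]
    refine div_le_div_of_nonneg_right ?_ (by positivity)
    have h1 : D ≤ log M := by
      rw [le_log_iff_exp_le hM0]
      exact Nat.le_ceil _
    have h2 : Pt / σ2 / (Pt / σ2 + 1) = Pt / (Pt + σ2) := by
      field_simp
    rw [h2]
    exact h1
  · obtain ⟨c, hc⟩ := exists_codebook_errorProb_le (P := P) hZ m
      (measurable_thresholdDecode Pt σ2 T (n := n) hM) Pt σ2
    exact ⟨c, hc.trans hrand⟩

end Coding

end WirelessPowered

theorem theorem2 {Ω : Type*} [MeasurableSpace Ω] (P : Measure Ω) [IsProbabilityMeasure P]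
    (lam η PPB mu Pt σ2 ε : ℝ)
    (hlam : 0 < lam) (hη : 2 < η) (hPPB : 0 < PPB) (hmu : 0 < mu) (hmu1 : mu ≤ 1)
    (hPt : 0 < Pt) (hσ2 : 0 < σ2) (hε : 0 < ε) (hε1 : ε < 1)
    (x : ℕ → Ω → Plane) (H : ℕ → Ω → ℝ)
    (hx : IsHomogeneousPPP P lam x) (hH : IsRayleighFading P x H) :
    (∀ s : ℝ, 0 ≤ s →
      laplace P (harvestedEnergy PPB mu η x H) s = laplaceClosedForm lam η (PPB * mu * s)) ∧
    ∀ m n : ℕ, 0 < m → Even n →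
      outageSum (laplace P (fun ω => harvestedEnergy PPB mu η x H ω / (mu * PPB))) m n
        (Pt / (mu * PPB)) ≤ ε / (2 + ε) →
      (Real.log ((2 + ε) / ε ^ 2)) ^ 4 ≤ (n : ℝ) →
      IsAchievable P (harvestedEnergy PPB mu η x H) Pt σ2 m n ε (rate ε (Pt / σ2) m n) := by
  refine ⟨fun s hs => laplace_harvestedEnergy hx hH hlam.le hη (by positivity), ?_⟩
  intro m n hm hn hout hlog
  -- The coding argument runs with this version of the energy; the outage hypothesis and the
  -- conclusion are transferred along the almost sure equality.
  obtain ⟨Z, hZ, hZ0, hae⟩ := exists_measurable_harvestedEnergy (PPB := PPB) (mu := mu)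
    hx.measurable hH (by positivity) η
  have hae' : (fun ω => harvestedEnergy PPB mu η x H ω / (mu * PPB)) =ᵐ[P]
      fun ω => Z ω / (mu * PPB) := by
    filter_upwards [hae] with ω hω
    rw [hω]
  rw [laplace_congr_ae hae'] at hout
  exact (IsAchievable.of_measurable hZ hZ0 hm hn hPt hσ2 (by positivity) hε hε1 hout
    hlog).congr_ae hae.symm
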